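/- **Setting.** Let $d\ge 1$ and let $p_1,\dots,p_N\subset\mathbb R^d$ be prototiles: nonempty compact sets equal to the closure of their interior (for example sets homeomorphic to the closed unit ball). A tile is a translate $p_i+u$, labelled by $i$. A tiling is a set of tiles with pairwise disjoint interiors that covers $\mathbb R^d$. Let $\lambda>1$ and let $\omega$ be a substitution: $\omega(p_i)$ is a finite set of tiles with pairwise disjoint interiors and union $\lambda p_i$, and $\omega(p_i+u)=\omega(p_i)+\lambda u$, $\omega(P)=\bigcup_{t\in P}\omega(t)$. Let $\Omega$ be the set of tilings each of whose finite patches is contained in a translate of some $\omega^k(p_j)$, $k\ge1$. Assume that $\omega$ is primitive, that $\Omega$ has finite local complexity, and that $\omega$ is injective on $\Omega$. For $U\subset\mathbb R^d$ let $T(U)$ be the set of tiles of $T$ that meet $U$, and $T(x)=T(\{x\})$; $T$ and $T'$ agree on $U$ if $T(U)=T'(U)$. Give $\Omega$ the metric $d(T,T')=\inf\big(\{1/\sqrt2\}\cup\{\varepsilon>0 : T+u,\ T'+v \text{ agree on } B_{1/\varepsilon}(0)\text{ for some } \|u\|,\|v\|<\varepsilon\}\big)$. Fix $0<\varepsilon_0<1/\sqrt2$.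 Write $T''=[T,T']$ if $T''=T'+v-u$ for some $u,v$ such that $\|u\|,\|v\|<\varepsilon$ and $T+u$, $T'+v$ agree on $B_{1/\varepsilon}(0)$ for some $\varepsilon<\varepsilon_0$ (for small $\varepsilon_0$ this is the single-valued Smale space bracket). Let $V^s(T)=\{T'\in\Omega: d(T,T')<\varepsilon_0,\ [T,T']=T'\}$ and $V^u(T)=\{T'\in\Omega: d(T,T')<\varepsilon_0,\ [T',T]=T'\}$. * The stable relation is $R_s=\bigcup_{n\ge0} G_n$, $G_n=\{(T,T')\in\Omega\times\Omega: \omega^n(T')\in V^s(\omega^n(T))\}$, with the inductive limit topology of the subspaces $G_n\subset\Omega\times\Omega$. * For $T\in\Omega$, the orbit $T+\mathbb R^d=\bigcup_{n\ge0}\omega^n(V^u(\omega^{-n}(T)))$ carries the inductive limit topology of these subspaces of $\Omega$. * $H_s(T)=R_s\cap\big((T+\mathbb R^d)\times(T+\mathbb R^d)\big)$ carries the Putnam–Spielberg topology, i.e. the topology inherited from $R_s\times(T+\mathbb R^d)\times(T+\mathbb R^d)$ under $(A,B)\mapsto((A,B),A,B)$: convergence means convergence in $R_s$ and of both entries in $T+\mathbb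 R^d$. * $R_n=\lambda^{-n}\{(x,y)\in\mathbb R^d\times\mathbb R^d:\ \omega^n(T)(x)-x=\omega^n(T)(y)-y\}$, and $R'_s=\bigcup_{n\ge0}R_n$ carries the inductive limit topology of the subspaces $R_n\subset\mathbb R^d\times\mathbb R^d$. **Proposition.** For every $T\in\Omega$, $R'_s$ is an étale equivalence relation on $\mathbb R^d$ (a topological groupoid whose range and source maps to $\mathbb R^d$ are local homeomorphisms), and the map $$R'_s\to H_s(T),\qquad (x,y)\mapsto(T-x,T-y),$$ is well defined and is an isomorphism of topological groupoids. -/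

import Mathlib

/-! ### Relations with a topology, viewed as groupoids -/

/-- The inductive limit topology on the union of a sequence of subspaces `X n` of `Y`: a set is
open iff its intersection with each `X n` is open in the subspace topology of `X n`. -/
abbrev indLimTopology {Y : Type*} [TopologicalSpace Y] (X : ℕ → Set Y) :
    TopologicalSpace {y : Y // y ∈ ⋃ n, X n} :=
  ⨆ n, TopologicalSpace.coinduced
    (fun y : {y : Y // y ∈ X n} => ⟨y.1, Set.mem_iUnion.2 ⟨n, y.2⟩⟩) instTopologicalSpaceSubtype

/-- A relation on `X`, whose graph carries a topology of its own (in general not the subspace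
topology of the product). -/
structure TopRelation (X : Type*) where
  rel : Set (X × X)
  top : TopologicalSpace {p : X × X // p ∈ rel}

namespace TopRelation

variable {X Y : Type*}

/-- The elements of the relation, i.e. the arrows of the associated groupoid. -/
def Arrow (R : TopRelation X) : Type _ := {p : X × X // p ∈ R.rel}

instance instTopologicalSpaceArrow (R : TopRelation X) : TopologicalSpace R.Arrow := R.top

def Arrow.range {R : TopRelation X} (g : R.Arrow) : X := g.1.1

def Arrow.source {R : TopRelation X} (g : R.Arrow) : X := g.1.2

/-- `R` is an equivalence relation on `X`. -/
def IsEquivalence (R : TopRelation X) : Prop := Equivalence fun x y => (x, y) ∈ R.rel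

/-- The composable pairs, a subspace of the product of two copies of the arrow space. -/
abbrev Composable (R : TopRelation X) : Type _ :=
  {p : R.Arrow × R.Arrow // p.1.source = p.2.range}

/-- Inversion `(x, y) ↦ (y, x)`. -/
def inv (R : TopRelation X) (h : R.IsEquivalence) (g : R.Arrow) : R.Arrow :=
  ⟨(g.source, g.range), h.symm g.2⟩

/-- Composition `(x, y) (y, z) = (x, z)`. -/
def comp (R : TopRelation X) (h : R.IsEquivalence) (p : R.Composable) : R.Arrow :=
  ⟨(p.1.1.range, p.1.2.source), by
    have h1 : (p.1.1.range, p.1.1.source) ∈ R.rel := p.1.1.2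
    have h2 : (p.1.2.range, p.1.2.source) ∈ R.rel := p.1.2.2
    rw [p.2] at h1
    exact h.trans h1 h2⟩

/-- An equivalence relation with a topology for which inversion and composition are continuous. -/
structure IsTopologicalGroupoid (R : TopRelation X) : Prop where
  equivalence : R.IsEquivalence
  continuous_inv : Continuous (R.inv equivalence)
  continuous_comp : Continuous (R.comp equivalence)

/-- An étale equivalence relation on a space `X`: a topological groupoid whose range and source
maps are local homeomorphisms to `X`. -/
structure IsEtale [TopologicalSpace X] (R : TopRelation X) : Prop where
  groupoid : R.IsTopologicalGroupoid
  range_localHomeo : IsLocalHomeomorph (Arrow.range : R.Arrow → X)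
  source_localHomeo : IsLocalHomeomorph (Arrow.source : R.Arrow → X)

/-- A topological groupoid isomorphism: a homeomorphism of the arrow spaces of two topological
groupoids that preserves and reflects composability, and preserves composition. -/
structure IsTopGroupoidIso (R : TopRelation X) (Q : TopRelation Y) (φ : R.Arrow → Q.Arrow) :
    Prop where
  groupoid_left : R.IsTopologicalGroupoid
  groupoid_right : Q.IsTopologicalGroupoid
  homeo : IsHomeomorph φ
  composable_iff : ∀ g h : R.Arrow, g.source = h.range ↔ (φ g).source = (φ h).range
  map_comp : ∀ p : R.Composable, φ (R.comp groupoid_left.equivalence p) =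
    Q.comp groupoid_right.equivalence ⟨(φ p.1.1, φ p.1.2), (composable_iff _ _).1 p.2⟩

end TopRelation

/-! ### Substitution tilings -/

/-- A translate of a prototile: the prototile of index `idx`, translated by `pos`. The index is
part of the tile, so it also plays the role of a label. -/
@[ext]
structure Tile (d : ℕ) (ι : Type*) where
  idx : ι
  pos : EuclideanSpace ℝ (Fin d)

namespace Tile

variable {d : ℕ} {ι : Type*}

/-- The tile `t + u`. -/
def translate (t : Tile d ι) (u : EuclideanSpace ℝ (Fin d)) : Tile d ι := ⟨t.idx, t.pos + u⟩

end Tile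

/-- The collection of tiles `P + u`. -/
def translatePatch {d : ℕ} {ι : Type*} (P : Set (Tile d ι)) (u : EuclideanSpace ℝ (Fin d)) :
    Set (Tile d ι) :=
  (fun t => t.translate u) '' P

/-- A substitution rule in `ℝ^d` with inflation factor `lam > 1`: prototiles `proto i`, and for
each of them a patch `sub i` of translates of prototiles that tiles `lam • proto i`. The prototiles
are nonempty compact sets that are the closure of their interior; every set homeomorphic to the
closed unit ball of `ℝ^d` is of this kind. -/
structure SubstitutionRule (d : ℕ) (ι : Type*) where
  proto : ι → Set (EuclideanSpace ℝ (Fin d))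
  proto_nonempty : ∀ i, (proto i).Nonempty
  proto_compact : ∀ i, IsCompact (proto i)
  proto_regular : ∀ i, closure (interior (proto i)) = proto i
  lam : ℝ
  one_lt_lam : 1 < lam
  sub : ι → Set (Tile d ι)
  sub_finite : ∀ i, (sub i).Finite
  sub_disjoint : ∀ i, (sub i).Pairwise fun s t =>
    Disjoint (interior ((fun x => x + s.pos) '' proto s.idx))
      (interior ((fun x => x + t.pos) '' proto t.idx))
  sub_cover : ∀ i, ⋃ t ∈ sub i, (fun x => x + t.pos) '' proto t.idx =
    (fun x => lam • x) '' proto i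

namespace SubstitutionRule

variable {d : ℕ} {ι : Type*} (S : SubstitutionRule d ι)

/-- The subset of `ℝ^d` occupied by a tile. -/
def supp (t : Tile d ι) : Set (EuclideanSpace ℝ (Fin d)) :=
  (fun x => x + t.pos) '' S.proto t.idx

/-- A tiling of `ℝ^d` by translates of the prototiles. -/
def IsTiling (T : Set (Tile d ι)) : Prop :=
  (T.Pairwise fun s t => Disjoint (interior (S.supp s)) (interior (S.supp t))) ∧
    ⋃ t ∈ T, S.supp t = Set.univ

/-- The substitution map `ω` on collections of tiles, `ω(p_i + u) = ω(p_i) + lam u`. -/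
def subst (P : Set (Tile d ι)) : Set (Tile d ι) :=
  ⋃ t ∈ P, translatePatch (S.sub t.idx) (S.lam • t.pos)

/-- Membership in the tiling space `Ω`: a tiling, all of whose finite patches are contained in a
translate of some `ω^k(p_j)`, `k ≥ 1`. -/
def MemOmega (T : Set (Tile d ι)) : Prop :=
  S.IsTiling T ∧ ∀ P : Set (Tile d ι), P ⊆ T → P.Finite →
    ∃ k : ℕ, 1 ≤ k ∧ ∃ (j : ι) (u : EuclideanSpace ℝ (Fin d)),
      P ⊆ translatePatch (S.subst^[k] {⟨j, 0⟩}) u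

/-- The substitution is primitive: for some `N ≥ 1`, every `ω^N(p_i)` contains a translate of every
prototile. -/
def IsPrimitive : Prop :=
  ∃ N : ℕ, 1 ≤ N ∧ ∀ i j : ι, ∃ t ∈ S.subst^[N] {⟨i, 0⟩}, t.idx = j

/-- Finite local complexity: for every `r`, the patches of diameter less than `r` that occur in
tilings in `Ω` fall into finitely many translation classes. -/
def HasFLC : Prop :=
  ∀ r : ℝ, ∃ F : Set (Set (Tile d ι)), F.Finite ∧
    ∀ T : Set (Tile d ι), S.MemOmega T → ∀ P : Set (Tile d ι), P ⊆ T → P.Finite →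
      Metric.diam (⋃ t ∈ P, S.supp t) < r → ∃ Q ∈ F, ∃ u, P = translatePatch Q u

/-- The substitution map is injective on the tiling space. -/
def IsInjective : Prop := Set.InjOn S.subst {T | S.MemOmega T}

/-- The tiles `T(U)` of `T` that meet `U`. -/
def tilesAt (T : Set (Tile d ι)) (U : Set (EuclideanSpace ℝ (Fin d))) : Set (Tile d ι) :=
  {t | t ∈ T ∧ (S.supp t ∩ U).Nonempty}

/-- `T` and `T'` agree on `U`. -/
def AgreeOn (T T' : Set (Tile d ι)) (U : Set (EuclideanSpace ℝ (Fin d))) : Prop :=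
  S.tilesAt T U = S.tilesAt T' U

/-- `T + u` and `T' + v` agree on the open ball of radius `1/ε` at the origin, and `u`, `v` have
norm less than `ε`. -/
def CloseBy (T T' : Set (Tile d ι)) (ε : ℝ) (u v : EuclideanSpace ℝ (Fin d)) : Prop :=
  ‖u‖ < ε ∧ ‖v‖ < ε ∧
    S.AgreeOn (translatePatch T u) (translatePatch T' v) (Metric.ball 0 (1 / ε))

/-- The tiling metric. -/
noncomputable def tilingDist (T T' : Set (Tile d ι)) : ℝ :=
  sInf ({1 / √2} ∪ {ε | ∃ u v, S.CloseBy T T' ε u v})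

/-- The tiling space `Ω`. -/
def Omega : Type _ := {T : Set (Tile d ι) // S.MemOmega T}

/-! The tiling metric satisfies the triangle inequality. -/

theorem translatePatch_add (P : Set (Tile d ι)) (u v : EuclideanSpace ℝ (Fin d)) :
    translatePatch (translatePatch P u) v = translatePatch P (u + v) := by
  simp only [translatePatch, Set.image_image, Tile.translate, add_assoc]

theorem supp_translate (t : Tile d ι) (u : EuclideanSpace ℝ (Fin d)) :
    S.supp (t.translate u) = (fun x => x + u) '' S.supp t := by
  simp only [supp, Tile.translate, Set.image_image, add_assoc]

theorem tilesAt_translate (P : Set (Tile d ι)) (u : EuclideanSpace ℝ (Fin d))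
    (U : Set (EuclideanSpace ℝ (Fin d))) :
    S.tilesAt (translatePatch P u) U =
      translatePatch (S.tilesAt P ((fun x => x + u) ⁻¹' U)) u := by
  ext t
  constructor
  · rintro ⟨⟨s, hs, rfl⟩, x, hx, hxU⟩
    rw [S.supp_translate] at hx
    obtain ⟨y, hy, rfl⟩ := hx
    exact ⟨s, ⟨hs, y, hy, hxU⟩, rfl⟩
  · rintro ⟨s, ⟨hs, y, hy, hyU⟩, rfl⟩
    refine ⟨⟨s, hs, rfl⟩, y + u, ?_, hyU⟩
    rw [S.supp_translate]
    exact ⟨y, hy, rfl⟩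

theorem AgreeOn.translate {S : SubstitutionRule d ι} {T T' : Set (Tile d ι)}
    {U V : Set (EuclideanSpace ℝ (Fin d))} (h : S.AgreeOn T T' U) (u : EuclideanSpace ℝ (Fin d))
    (hV : ∀ x ∈ V, x - u ∈ U) :
    S.AgreeOn (translatePatch T u) (translatePatch T' u) V := by
  have key : ∀ A B : Set (Tile d ι), S.AgreeOn A B U →
      S.tilesAt (translatePatch A u) V ⊆ S.tilesAt (translatePatch B u) V := by
    rintro A B hAB t ⟨⟨s, hs, rfl⟩, x, hx, hxV⟩
    have hx' := hx
    rw [S.supp_translate] at hx'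
    obtain ⟨y, hy, rfl⟩ := hx'
    have hyU : y ∈ U := by simpa using hV _ hxV
    have hsB : s ∈ S.tilesAt B U := by
      rw [← hAB]
      exact ⟨hs, y, hy, hyU⟩
    exact ⟨⟨s, hsB.1, rfl⟩, y + u, hx, hxV⟩
  exact Set.Subset.antisymm (key T T' h) (key T' T h.symm)

theorem CloseBy.pos {S : SubstitutionRule d ι} {T T' : Set (Tile d ι)} {ε : ℝ}
    {u v : EuclideanSpace ℝ (Fin d)} (h : S.CloseBy T T' ε u v) : 0 < ε :=
  (norm_nonneg u).trans_lt h.1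

theorem bddBelow_dist (T T' : Set (Tile d ι)) :
    BddBelow ({1 / √2} ∪ {ε | ∃ u v, S.CloseBy T T' ε u v}) := by
  refine ⟨0, ?_⟩
  rintro ε (rfl | ⟨u, v, h⟩)
  · positivity
  · exact h.pos.le

theorem tilingDist_le (T T' : Set (Tile d ι)) : S.tilingDist T T' ≤ 1 / √2 :=
  csInf_le (S.bddBelow_dist T T') (Or.inl rfl)

theorem tilingDist_nonneg (T T' : Set (Tile d ι)) : 0 ≤ S.tilingDist T T' := by
  refine le_csInf ⟨_, Or.inl rfl⟩ ?_
  rintro ε (rfl | ⟨u, v, h⟩)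
  · positivity
  · exact h.pos.le

theorem tilingDist_self (T : Set (Tile d ι)) : S.tilingDist T T = 0 := by
  refine le_antisymm (le_of_forall_pos_le_add fun ε hε => ?_) (S.tilingDist_nonneg T T)
  rw [zero_add]
  exact csInf_le (S.bddBelow_dist T T) (Or.inr ⟨0, 0, by simpa using hε, by simpa using hε, rfl⟩)

theorem tilingDist_comm (T T' : Set (Tile d ι)) : S.tilingDist T T' = S.tilingDist T' T := by
  have : ∀ ε, (∃ u v, S.CloseBy T T' ε u v) ↔ ∃ u v, S.CloseBy T' T ε u v := fun ε =>
    ⟨fun ⟨u, v, h⟩ => ⟨v, u, h.2.1, h.1, h.2.2.symm⟩,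
      fun ⟨u, v, h⟩ => ⟨v, u, h.2.1, h.1, h.2.2.symm⟩⟩
  simp only [tilingDist, this]

theorem tilingDist_triangle (A B C : Set (Tile d ι)) :
    S.tilingDist A C ≤ S.tilingDist A B + S.tilingDist B C := by
  have h2 : (1 / √2) * (1 / √2) = (1 : ℝ) / 2 := by
    rw [div_mul_div_comm, Real.mul_self_sqrt (by norm_num)]; norm_num
  have hs : (0 : ℝ) < 1 / √2 := by positivity
  refine le_of_forall_pos_le_add fun δ hδ => ?_
  obtain ⟨a, ha, hab⟩ := exists_lt_of_csInf_lt (s := {1 / √2} ∪ {ε | ∃ u v, S.CloseBy A B ε u v})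
    ⟨_, Or.inl rfl⟩ (show S.tilingDist A B < S.tilingDist A B + δ / 2 by linarith)
  obtain ⟨b, hb, hbc⟩ := exists_lt_of_csInf_lt (s := {1 / √2} ∪ {ε | ∃ u v, S.CloseBy B C ε u v})
    ⟨_, Or.inl rfl⟩ (show S.tilingDist B C < S.tilingDist B C + δ / 2 by linarith)
  have hAC := S.tilingDist_le A C
  have ha0 : 0 < a := by
    rcases ha with rfl | ⟨u, v, h⟩
    exacts [hs, h.pos]
  have hb0 : 0 < b := by
    rcases hb with rfl | ⟨u, v, h⟩
    exacts [hs, h.pos]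
  suffices S.tilingDist A C ≤ a + b by linarith
  by_cases hlarge : 1 / √2 ≤ a + b
  · linarith
  push Not at hlarge
  rcases ha with ha | ⟨u₁, v₁, h₁⟩
  · rw [Set.mem_singleton_iff] at ha
    linarith
  rcases hb with hb | ⟨u₂, v₂, h₂⟩
  · rw [Set.mem_singleton_iff] at hb
    linarith
  refine csInf_le (S.bddBelow_dist A C) (Or.inr ⟨u₁ + u₂, v₁ + v₂, ?_, ?_, ?_⟩)
  · exact (norm_add_le _ _).trans_lt (add_lt_add h₁.1 h₂.1)
  · exact (norm_add_le _ _).trans_lt (add_lt_add h₁.2.1 h₂.2.1)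
  have hsum : (a + b) * (a + b) ≤ 1 := by nlinarith
  have hr1 : 1 / (a + b) + b ≤ 1 / a := by
    rw [div_add' _ _ _ (by positivity), div_le_div_iff₀ (by positivity) ha0]
    nlinarith [mul_pos ha0 hb0]
  have hr2 : 1 / (a + b) + a ≤ 1 / b := by
    rw [div_add' _ _ _ (by positivity), div_le_div_iff₀ (by positivity) hb0]
    nlinarith [mul_pos ha0 hb0]
  have e1 := h₁.2.2.translate (V := Metric.ball 0 (1 / (a + b))) u₂ fun x hx => by
    rw [mem_ball_zero_iff] at hx ⊢
    linarith [norm_sub_le x u₂, h₂.1]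
  have e2 := h₂.2.2.translate (V := Metric.ball 0 (1 / (a + b))) v₁ fun x hx => by
    rw [mem_ball_zero_iff] at hx ⊢
    linarith [norm_sub_le x v₁, h₁.2.1]
  rw [translatePatch_add, translatePatch_add] at e1 e2
  rw [add_comm u₂ v₁, add_comm v₂ v₁] at e2
  exact e1.trans e2

/-- The metric topology on the tiling space. -/
noncomputable instance : PseudoMetricSpace S.Omega where
  dist T T' := S.tilingDist T.1 T'.1
  dist_self T := S.tilingDist_self T.1
  dist_comm T T' := S.tilingDist_comm T.1 T'.1
  dist_triangle A B C := S.tilingDist_triangle A.1 B.1 C.1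

/-- The relation `T'' = [T, T']` of the Smale space bracket at scale `ε₀`: there are vectors `u`,
`v` of norm less than some `ε < ε₀` such that `T + u` and `T' + v` agree on the ball of radius
`1/ε`, and `T'' = T' + v - u`. (So `[T, T']` is a translate of `T'` that agrees with `T` around
the origin. For small `ε₀` the vector `v - u` is unique.) -/
def IsBracket (ε₀ : ℝ) (T T' T'' : Set (Tile d ι)) : Prop :=
  ∃ ε < ε₀, ∃ u v, S.CloseBy T T' ε u v ∧ T'' = translatePatch T' (v - u)

/-- `T' ∈ V^s(T, ε₀)`, i.e. `d(T, T') < ε₀` and `[T, T'] = T'`. -/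
def MemLocalStable (ε₀ : ℝ) (T T' : Set (Tile d ι)) : Prop :=
  S.tilingDist T T' < ε₀ ∧ S.IsBracket ε₀ T T' T'

/-- `T' ∈ V^u(T, ε₀)`, i.e. `d(T, T') < ε₀` and `[T', T] = T'`. -/
def MemLocalUnstable (ε₀ : ℝ) (T T' : Set (Tile d ι)) : Prop :=
  S.tilingDist T T' < ε₀ ∧ S.IsBracket ε₀ T' T T'

/-- `G_n^s = (ω × ω)^{-n} {(T, T') | T' ∈ V^s(T, ε₀)}`. -/
def stableStep (ε₀ : ℝ) (n : ℕ) : Set (S.Omega × S.Omega) :=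
  {p | S.MemLocalStable ε₀ (S.subst^[n] p.1.1) (S.subst^[n] p.2.1)}

/-- The stable equivalence relation `R_s = ⋃ G_n^s` on `Ω` with the inductive limit topology. -/
noncomputable def stableRel (ε₀ : ℝ) : TopRelation S.Omega where
  rel := ⋃ n, S.stableStep ε₀ n
  top := indLimTopology (S.stableStep ε₀)

/-- `V_n^u(T) = ω^n (V^u(ω^{-n}(T), ε₀))`. -/
def unstableStep (ε₀ : ℝ) (T : S.Omega) (n : ℕ) : Set S.Omega :=
  {T' | ∃ A A' : S.Omega, S.subst^[n] A.1 = T.1 ∧ S.MemLocalUnstable ε₀ A.1 A'.1 ∧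
    T'.1 = S.subst^[n] A'.1}

/-- The unstable class `[T]_{R_u} = T + ℝ^d = ⋃ V_n^u(T)`. -/
def UnstableClass (ε₀ : ℝ) (T : S.Omega) : Type _ :=
  {T' : S.Omega // T' ∈ ⋃ n, S.unstableStep ε₀ T n}

/-- `T + ℝ^d` carries the inductive limit topology of the `V_n^u(T)`, not the subspace topology
of `Ω`. -/
noncomputable instance instTopologicalSpaceUnstableClass (ε₀ : ℝ) (T : S.Omega) :
    TopologicalSpace (S.UnstableClass ε₀ T) :=
  indLimTopology (S.unstableStep ε₀ T)

/-- The relation `H_s(T) = R_s ∩ ((T + ℝ^d) × (T + ℝ^d))` on `T + ℝ^d`. Its topology is the one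
inherited from `R_s × (T + ℝ^d) × (T + ℝ^d)`: convergence in `H_s(T)` means convergence in `R_s`
together with convergence of both entries in `T + ℝ^d`. -/
noncomputable def transversal (ε₀ : ℝ) (T : S.Omega) : TopRelation (S.UnstableClass ε₀ T) where
  rel := {p | (p.1.1, p.2.1) ∈ (S.stableRel ε₀).rel}
  top :=
    TopologicalSpace.induced (fun p => ⟨(p.1.1.1, p.1.2.1), p.2⟩) (S.stableRel ε₀).top ⊓
      (TopologicalSpace.induced (fun p => p.1.1)
          (instTopologicalSpaceUnstableClass S ε₀ T) ⊓
        TopologicalSpace.induced (fun p => p.1.2)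
          (instTopologicalSpaceUnstableClass S ε₀ T))

/-- `R(T) = {(x, y) | T(x) - x = T(y) - y}`, where `T(x)` is the set of tiles of `T` containing
`x`. -/
def tilingRel (T : Set (Tile d ι)) :
    Set (EuclideanSpace ℝ (Fin d) × EuclideanSpace ℝ (Fin d)) :=
  {p | translatePatch (S.tilesAt T {p.1}) (-p.1) = translatePatch (S.tilesAt T {p.2}) (-p.2)}

/-- `R_n = lam^{-n} R(ω^n(T))`. -/
def relStep (T : S.Omega) (n : ℕ) :
    Set (EuclideanSpace ℝ (Fin d) × EuclideanSpace ℝ (Fin d)) :=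
  (fun p => (S.lam ^ n)⁻¹ • p) '' S.tilingRel (S.subst^[n] T.1)

/-- `R'_s = ⋃ R_n` with the inductive limit topology of the subspaces `R_n` of `ℝ^d × ℝ^d`. -/
def unionRel (T : S.Omega) : TopRelation (EuclideanSpace ℝ (Fin d)) where
  rel := ⋃ n, S.relStep T n
  top := indLimTopology (S.relStep T)

end SubstitutionRule

open Set Filter Topology Metric

section Translation

variable {d : ℕ} {ι : Type*}

theorem mem_translatePatch {P : Set (Tile d ι)} {u : EuclideanSpace ℝ (Fin d)} {t : Tile d ι} :
    t ∈ translatePatch P u ↔ t.translate (-u) ∈ P := by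
  constructor
  · rintro ⟨s, hs, rfl⟩
    simpa [Tile.translate] using hs
  · intro h
    exact ⟨_, h, by simp [Tile.translate]⟩

theorem Tile.translate_mem_translatePatch {P : Set (Tile d ι)} {u : EuclideanSpace ℝ (Fin d)}
    {t : Tile d ι} (h : t ∈ P) : t.translate u ∈ translatePatch P u :=
  ⟨t, h, rfl⟩

@[simp]
theorem translatePatch_zero (P : Set (Tile d ι)) : translatePatch P 0 = P := by
  ext t
  simp [mem_translatePatch, Tile.translate]

theorem translatePatch_mono {P Q : Set (Tile d ι)} (h : P ⊆ Q) (u : EuclideanSpace ℝ (Fin d)) :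
    translatePatch P u ⊆ translatePatch Q u :=
  image_mono h

end Translation

namespace SubstitutionRule

variable {d : ℕ} {ι : Type*} (S : SubstitutionRule d ι)

theorem lam_pos : 0 < S.lam := zero_lt_one.trans S.one_lt_lam

theorem lam_ne_zero : S.lam ≠ 0 := S.lam_pos.ne'

theorem lam_pow_pos (n : ℕ) : 0 < S.lam ^ n := pow_pos S.lam_pos n

theorem lam_pow_ne_zero (n : ℕ) : S.lam ^ n ≠ 0 := (S.lam_pow_pos n).ne'

theorem exists_lt_lam_pow_mul (a : ℝ) {b : ℝ} (hb : 0 < b) : ∃ n : ℕ, a < S.lam ^ n * b := by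
  obtain ⟨n, hn⟩ := pow_unbounded_of_one_lt (a / b) S.one_lt_lam
  exact ⟨n, (div_lt_iff₀ hb).1 hn⟩

theorem mem_supp {t : Tile d ι} {x : EuclideanSpace ℝ (Fin d)} :
    x ∈ S.supp t ↔ x - t.pos ∈ S.proto t.idx := by
  simp [supp, sub_eq_add_neg]

theorem mem_supp_translate {t : Tile d ι} {u x : EuclideanSpace ℝ (Fin d)} :
    x ∈ S.supp (t.translate u) ↔ x - u ∈ S.supp t := by
  simp [mem_supp, Tile.translate, sub_sub, add_comm]

theorem interior_supp (t : Tile d ι) :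
    interior (S.supp t) = (fun x => x + t.pos) '' interior (S.proto t.idx) :=
  ((Homeomorph.addRight t.pos).image_interior _).symm

theorem isCompact_supp (t : Tile d ι) : IsCompact (S.supp t) :=
  (S.proto_compact _).image (by fun_prop)

theorem closure_interior_supp (t : Tile d ι) : closure (interior (S.supp t)) = S.supp t := by
  rw [interior_supp, supp]
  conv_rhs => rw [← S.proto_regular t.idx]
  exact ((Homeomorph.addRight t.pos).image_closure _).symm

theorem interior_proto_nonempty (i : ι) : (interior (S.proto i)).Nonempty := by
  rw [← closure_nonempty_iff, S.proto_regular]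
  exact S.proto_nonempty i

theorem interior_supp_nonempty (t : Tile d ι) : (interior (S.supp t)).Nonempty := by
  rw [interior_supp]
  exact (S.interior_proto_nonempty _).image _

/-! ### The substitution map and translations -/

theorem mem_subst {P : Set (Tile d ι)} {s : Tile d ι} :
    s ∈ S.subst P ↔ ∃ t ∈ P, s ∈ translatePatch (S.sub t.idx) (S.lam • t.pos) := by
  simp [subst]

theorem subst_mono {P Q : Set (Tile d ι)} (h : P ⊆ Q) : S.subst P ⊆ S.subst Q :=
  biUnion_subset_biUnion_left h

theorem subst_iterate_mono {P Q : Set (Tile d ι)} (h : P ⊆ Q) (n : ℕ) :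
    S.subst^[n] P ⊆ S.subst^[n] Q := by
  induction n generalizing P Q with
  | zero => exact h
  | succ n ih => exact ih (S.subst_mono h)

theorem subst_translatePatch (P : Set (Tile d ι)) (u : EuclideanSpace ℝ (Fin d)) :
    S.subst (translatePatch P u) = translatePatch (S.subst P) (S.lam • u) := by
  ext s
  rw [mem_translatePatch, mem_subst, mem_subst]
  constructor
  · rintro ⟨_, ⟨t, ht, rfl⟩, hs⟩
    refine ⟨t, ht, ?_⟩
    rw [mem_translatePatch] at hs ⊢
    simpa [Tile.translate, add_assoc, add_comm, add_left_comm] using hs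
  · rintro ⟨t, ht, hs⟩
    refine ⟨t.translate u, ⟨t, ht, rfl⟩, ?_⟩
    rw [mem_translatePatch] at hs ⊢
    simpa [Tile.translate, add_assoc, add_comm, add_left_comm] using hs

theorem subst_iterate_translatePatch (n : ℕ) (P : Set (Tile d ι))
    (u : EuclideanSpace ℝ (Fin d)) :
    S.subst^[n] (translatePatch P u) = translatePatch (S.subst^[n] P) (S.lam ^ n • u) := by
  induction n generalizing P u with
  | zero => simp
  | succ n ih =>
    rw [Function.iterate_succ_apply, Function.iterate_succ_apply, subst_translatePatch, ih,
      smul_smul, pow_succ]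

/-- The tiles of `ω(t)` cover exactly `lam • t`. -/
theorem lam_smul_mem_iff {t : Tile d ι} {x : EuclideanSpace ℝ (Fin d)} :
    (∃ s ∈ translatePatch (S.sub t.idx) (S.lam • t.pos), S.lam • x ∈ S.supp s) ↔
      x ∈ S.supp t := by
  have h : (S.lam • (x - t.pos) ∈ ⋃ s ∈ S.sub t.idx, S.supp s) ↔
      S.lam • (x - t.pos) ∈ (fun x => S.lam • x) '' S.proto t.idx := by
    rw [← S.sub_cover t.idx]; rfl
  rw [mem_supp, ← (smul_right_injective _ S.lam_ne_zero).mem_set_image, ← h]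
  simp only [mem_iUnion, exists_prop, translatePatch, exists_mem_image, mem_supp_translate,
    smul_sub]

theorem inv_smul_mem_supp {t s : Tile d ι} {x : EuclideanSpace ℝ (Fin d)}
    (hs : s ∈ translatePatch (S.sub t.idx) (S.lam • t.pos)) (hx : x ∈ S.supp s) :
    S.lam⁻¹ • x ∈ S.supp t :=
  S.lam_smul_mem_iff.1 ⟨s, hs, by rwa [smul_inv_smul₀ S.lam_ne_zero]⟩

theorem AgreeOn.mono {S : SubstitutionRule d ι} {A B : Set (Tile d ι)}
    {U V : Set (EuclideanSpace ℝ (Fin d))} (h : S.AgreeOn A B U) (hVU : V ⊆ U) :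
    S.AgreeOn A B V := by
  have key : ∀ A B : Set (Tile d ι), S.AgreeOn A B U → S.tilesAt A V ⊆ S.tilesAt B V := by
    rintro A B hAB t ⟨ht, x, hx, hxV⟩
    have : t ∈ S.tilesAt B U := hAB ▸ ⟨ht, x, hx, hVU hxV⟩
    exact ⟨this.1, x, hx, hxV⟩
  exact Subset.antisymm (key A B h) (key B A h.symm)

theorem AgreeOn.trans {S : SubstitutionRule d ι} {A B C : Set (Tile d ι)}
    {U : Set (EuclideanSpace ℝ (Fin d))} (h : S.AgreeOn A B U) (h' : S.AgreeOn B C U) :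
    S.AgreeOn A C U :=
  Eq.trans h h'

theorem AgreeOn.symm {S : SubstitutionRule d ι} {A B : Set (Tile d ι)}
    {U : Set (EuclideanSpace ℝ (Fin d))} (h : S.AgreeOn A B U) : S.AgreeOn B A U :=
  Eq.symm h

theorem AgreeOn.mem_iff {S : SubstitutionRule d ι} {A B : Set (Tile d ι)}
    {U : Set (EuclideanSpace ℝ (Fin d))} (h : S.AgreeOn A B U) {t : Tile d ι}
    {x : EuclideanSpace ℝ (Fin d)} (hx : x ∈ S.supp t) (hxU : x ∈ U) : t ∈ A ↔ t ∈ B := by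
  have : t ∈ S.tilesAt A U ↔ t ∈ S.tilesAt B U := by rw [h]
  have hne : (S.supp t ∩ U).Nonempty := ⟨x, hx, hxU⟩
  simpa [tilesAt, hne] using this

/-- Two patches agree on `U` iff they have the same tiles at every point of `U`. -/
theorem agreeOn_of_forall {S : SubstitutionRule d ι} {A B : Set (Tile d ι)}
    {U : Set (EuclideanSpace ℝ (Fin d))}
    (h : ∀ x ∈ U, ∀ t, x ∈ S.supp t → (t ∈ A ↔ t ∈ B)) : S.AgreeOn A B U := by
  ext t
  constructor
  · rintro ⟨ht, x, hx, hxU⟩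
    exact ⟨(h x hxU t hx).1 ht, x, hx, hxU⟩
  · rintro ⟨ht, x, hx, hxU⟩
    exact ⟨(h x hxU t hx).2 ht, x, hx, hxU⟩

theorem AgreeOn.subst {S : SubstitutionRule d ι} {A B : Set (Tile d ι)}
    {U V : Set (EuclideanSpace ℝ (Fin d))} (h : S.AgreeOn A B U)
    (hVU : ∀ x ∈ V, S.lam⁻¹ • x ∈ U) : S.AgreeOn (S.subst A) (S.subst B) V := by
  refine agreeOn_of_forall fun x hxV t hx => ?_
  rw [mem_subst, mem_subst]
  constructor
  · rintro ⟨s, hs, hst⟩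
    exact ⟨s, (h.mem_iff (S.inv_smul_mem_supp hst hx) (hVU x hxV)).1 hs, hst⟩
  · rintro ⟨s, hs, hst⟩
    exact ⟨s, (h.mem_iff (S.inv_smul_mem_supp hst hx) (hVU x hxV)).2 hs, hst⟩

theorem AgreeOn.subst_iterate {S : SubstitutionRule d ι} {A B : Set (Tile d ι)} (n : ℕ)
    {U V : Set (EuclideanSpace ℝ (Fin d))} (h : S.AgreeOn A B U)
    (hVU : ∀ x ∈ V, (S.lam ^ n)⁻¹ • x ∈ U) :
    S.AgreeOn (S.subst^[n] A) (S.subst^[n] B) V := by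
  induction n generalizing A B U with
  | zero => exact h.mono fun x hx => by simpa using hVU x hx
  | succ n ih =>
    refine ih (U := (fun x => S.lam • x) '' U) (h.subst ?_) ?_
    · rintro _ ⟨y, hy, rfl⟩
      simpa [inv_smul_smul₀ S.lam_ne_zero] using hy
    · intro x hx
      refine ⟨_, hVU x hx, ?_⟩
      have := S.lam_ne_zero
      simp only [smul_smul]
      congr 1
      field_simp
      ring

/-! ### Separation of tiles and local finiteness -/

theorem exists_separation [Finite ι] : ∃ ρ : ℝ, 0 < ρ ∧
    ∀ i, ∃ c, ball c ρ ⊆ interior (S.proto i) := by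
  have h : ∀ i, ∃ ρ : ℝ, 0 < ρ ∧ ∃ c, ball c ρ ⊆ interior (S.proto i) := by
    intro i
    obtain ⟨c, hc⟩ := S.interior_proto_nonempty i
    obtain ⟨ρ, hρ, h⟩ := Metric.isOpen_iff.1 isOpen_interior c hc
    exact ⟨ρ, hρ, c, h⟩
  choose r hr h using h
  cases isEmpty_or_nonempty ι with
  | inl _ => exact ⟨1, one_pos, fun i => isEmptyElim i⟩
  | inr _ =>
    obtain ⟨j, hj⟩ := Finite.exists_min r
    exact ⟨r j, hr j, fun i => (h i).imp fun c hc => (ball_subset_ball (hj i)).trans hc⟩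

/-- A number such that distinct tiles with equal labels in a packing are at least that far apart. -/
noncomputable def sep [Finite ι] : ℝ := S.exists_separation.choose

theorem sep_pos [Finite ι] : 0 < S.sep := S.exists_separation.choose_spec.1

/-- The collection `A` consists of tiles with pairwise disjoint interiors. -/
def IsPacking (A : Set (Tile d ι)) : Prop :=
  A.Pairwise fun s t => Disjoint (interior (S.supp s)) (interior (S.supp t))

variable {S}

theorem MemOmega.isPacking {A : Set (Tile d ι)} (h : S.MemOmega A) : S.IsPacking A := h.1.1

theorem MemOmega.exists_mem {A : Set (Tile d ι)} (h : S.MemOmega A)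
    (x : EuclideanSpace ℝ (Fin d)) : ∃ t ∈ A, x ∈ S.supp t := by
  have : x ∈ ⋃ t ∈ A, S.supp t := h.1.2 ▸ mem_univ x
  simpa using this

theorem IsPacking.eq_of_dist_lt [Finite ι] {A : Set (Tile d ι)} (hA : S.IsPacking A)
    {s t : Tile d ι} (hs : s ∈ A) (ht : t ∈ A) (hidx : s.idx = t.idx)
    (hpos : ‖s.pos - t.pos‖ < S.sep) : s = t := by
  by_contra hne
  obtain ⟨c, hc⟩ := S.exists_separation.choose_spec.2 t.idx
  refine (hA hs ht hne).notMem_of_mem_left (a := c + s.pos) ?_ ?_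
  · rw [interior_supp, hidx]
    exact ⟨c, hc (mem_ball_self S.sep_pos), rfl⟩
  · rw [interior_supp]
    refine ⟨c + (s.pos - t.pos), hc ?_, by simp only [add_assoc, sub_add_cancel]⟩
    simpa [mem_ball_iff_norm, sep] using hpos

theorem IsPacking.eq_zero_of_translate_mem [Finite ι] {A : Set (Tile d ι)} (hA : S.IsPacking A)
    {t : Tile d ι} {u : EuclideanSpace ℝ (Fin d)} (ht : t ∈ A) (ht' : t.translate u ∈ A)
    (hu : ‖u‖ < S.sep) : u = 0 := by
  have := hA.eq_of_dist_lt ht' ht rfl (by simpa [Tile.translate] using hu)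
  simpa [Tile.translate, Tile.ext_iff] using this

variable (S) in
theorem exists_proto_bound [Finite ι] : ∃ D : ℝ, ∀ i, ∀ x ∈ S.proto i, ‖x‖ ≤ D := by
  have : Bornology.IsBounded (⋃ i, S.proto i) :=
    (isCompact_iUnion fun i => S.proto_compact i).isBounded
  obtain ⟨D, hD⟩ := this.exists_norm_le
  exact ⟨D, fun i x hx => hD x (mem_iUnion.2 ⟨i, hx⟩)⟩

theorem IsPacking.finite_tilesAt_ball [Finite ι] {A : Set (Tile d ι)} (hA : S.IsPacking A)
    (r : ℝ) : (S.tilesAt A (ball 0 r)).Finite := by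
  obtain ⟨D, hD⟩ := S.exists_proto_bound
  obtain ⟨F, -, hF, hcov⟩ :=
    (isCompact_closedBall (0 : EuclideanSpace ℝ (Fin d)) (r + D)).finite_cover_balls
      (half_pos S.sep_pos)
  have h : ∀ t ∈ S.tilesAt A (ball 0 r), ∃ c ∈ F, t.pos ∈ ball c (S.sep / 2) := by
    rintro t ⟨-, x, hx, hxr⟩
    rw [mem_supp] at hx
    have h1 := hD _ _ hx
    have h2 : t.pos ∈ closedBall (0 : EuclideanSpace ℝ (Fin d)) (r + D) := by
      rw [mem_ball_zero_iff] at hxr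
      rw [mem_closedBall_zero_iff]
      have := norm_sub_le x (x - t.pos)
      rw [sub_sub_cancel] at this
      linarith
    simpa using hcov h2
  choose! f hfF hf using h
  refine Finite.of_finite_image (f := fun t => (t.idx, f t))
    ((Set.finite_univ.prod hF).subset ?_) ?_
  · rintro _ ⟨t, ht, rfl⟩
    exact ⟨mem_univ _, hfF t ht⟩
  · intro s hs t ht hst
    simp only [Prod.mk.injEq] at hst
    refine hA.eq_of_dist_lt hs.1 ht.1 hst.1 ?_
    have h1 := hf s hs
    have h2 := hf t ht
    rw [hst.2] at h1
    rw [mem_ball] at h1 h2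
    rw [← dist_eq_norm]
    linarith [dist_triangle_right s.pos t.pos (f t)]

/-- Near a point `x`, a packing has no other tiles than those containing `x`. -/
theorem IsPacking.eventually_mem_supp [Finite ι] {A : Set (Tile d ι)} (hA : S.IsPacking A)
    (x : EuclideanSpace ℝ (Fin d)) :
    ∀ᶠ y in 𝓝 x, ∀ t ∈ A, y ∈ S.supp t → x ∈ S.supp t := by
  have hfin := hA.finite_tilesAt_ball (‖x‖ + 1)
  have h1 : ∀ᶠ y in 𝓝 x, ∀ t ∈ S.tilesAt A (ball 0 (‖x‖ + 1)), y ∈ S.supp t → x ∈ S.supp t := by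
    rw [eventually_all_finite hfin]
    intro t _
    by_cases hx : x ∈ S.supp t
    · exact Eventually.of_forall fun _ _ => hx
    · filter_upwards [(S.isCompact_supp t).isClosed.isOpen_compl.mem_nhds hx] with y hy hy'
      exact absurd hy' hy
  have h2 : ∀ᶠ y in 𝓝 x, y ∈ ball (0 : EuclideanSpace ℝ (Fin d)) (‖x‖ + 1) :=
    isOpen_ball.mem_nhds (by simp)
  filter_upwards [h1, h2] with y h1 h2 t ht hy
  exact h1 t ⟨ht, y, hy, h2⟩ hy

/-- Packings with the same tiles at `x` agree on a neighbourhood of `x`. -/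
theorem IsPacking.exists_agreeOn_ball [Finite ι] {A B : Set (Tile d ι)} (hA : S.IsPacking A)
    (hB : S.IsPacking B) {x : EuclideanSpace ℝ (Fin d)} (h : S.AgreeOn A B {x}) :
    ∃ r > 0, S.AgreeOn A B (ball x r) := by
  obtain ⟨r, hr, hr'⟩ := Metric.eventually_nhds_iff_ball.1
    ((hA.eventually_mem_supp x).and (hB.eventually_mem_supp x))
  refine ⟨r, hr, agreeOn_of_forall fun y hy t hyt => ⟨fun ht => ?_, fun ht => ?_⟩⟩
  · exact (h.mem_iff ((hr' y hy).1 t ht hyt) rfl).1 ht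
  · exact (h.mem_iff ((hr' y hy).2 t ht hyt) rfl).2 ht

/-! ### The tiling space is invariant under translation and substitution -/

theorem IsPacking.translate {A : Set (Tile d ι)} (hA : S.IsPacking A)
    (u : EuclideanSpace ℝ (Fin d)) : S.IsPacking (translatePatch A u) := by
  rintro _ ⟨s, hs, rfl⟩ _ ⟨t, ht, rfl⟩ hne
  have hne' : s ≠ t := fun h => hne (by rw [h])
  have h := hA hs ht hne'
  have e : ∀ t : Tile d ι,
      interior (S.supp (t.translate u)) = (fun x => x + u) '' interior (S.supp t) := fun t => by
    rw [supp_translate]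
    exact ((Homeomorph.addRight u).image_interior _).symm
  simp only [e]
  exact (disjoint_image_iff (add_left_injective u)).2 h

theorem IsTiling.translate {A : Set (Tile d ι)} (hA : S.IsTiling A)
    (u : EuclideanSpace ℝ (Fin d)) : S.IsTiling (translatePatch A u) := by
  refine ⟨IsPacking.translate hA.1 u, eq_univ_of_forall fun x => ?_⟩
  have : x - u ∈ ⋃ t ∈ A, S.supp t := hA.2 ▸ mem_univ _
  simp only [mem_iUnion, exists_prop] at this ⊢
  obtain ⟨t, ht, hx⟩ := this
  exact ⟨_, Tile.translate_mem_translatePatch ht, S.mem_supp_translate.2 hx⟩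

theorem MemOmega.translate {A : Set (Tile d ι)} (hA : S.MemOmega A)
    (u : EuclideanSpace ℝ (Fin d)) : S.MemOmega (translatePatch A u) := by
  refine ⟨hA.1.translate u, fun P hP hfin => ?_⟩
  obtain ⟨k, hk, j, v, h⟩ := hA.2 (translatePatch P (-u)) (by
    have := translatePatch_mono hP (-u)
    rwa [translatePatch_add, add_neg_cancel, translatePatch_zero] at this) (hfin.image _)
  refine ⟨k, hk, j, v + u, ?_⟩
  have := translatePatch_mono h u
  rwa [translatePatch_add, translatePatch_add, neg_add_cancel, translatePatch_zero] at this

theorem lam_smul_interior_subset {t s : Tile d ι}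
    (hs : s ∈ translatePatch (S.sub t.idx) (S.lam • t.pos)) :
    (fun x => S.lam⁻¹ • x) '' interior (S.supp s) ⊆ interior (S.supp t) := by
  refine interior_maximal ?_ ?_
  · rintro _ ⟨x, hx, rfl⟩
    exact S.inv_smul_mem_supp hs (interior_subset hx)
  · exact (Homeomorph.smulOfNeZero S.lam⁻¹ (inv_ne_zero S.lam_ne_zero)).isOpenMap _
      isOpen_interior

theorem IsPacking.subst {A : Set (Tile d ι)} (hA : S.IsPacking A) : S.IsPacking (S.subst A) := by
  intro s hs s' hs' hne
  rw [mem_subst] at hs hs'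
  obtain ⟨t, ht, hst⟩ := hs
  obtain ⟨t', ht', hst'⟩ := hs'
  by_cases htt : t = t'
  · subst htt
    exact IsPacking.translate (S := S) (A := S.sub t.idx) (S.sub_disjoint t.idx) _ hst hst' hne
  · have := hA ht ht' htt
    refine Set.disjoint_left.2 fun x hx hx' => Set.disjoint_left.1 this
      (lam_smul_interior_subset hst ⟨x, hx, rfl⟩) (lam_smul_interior_subset hst' ⟨x, hx', rfl⟩)

theorem MemOmega.subst {A : Set (Tile d ι)} (hA : S.MemOmega A) : S.MemOmega (S.subst A) := by
  refine ⟨⟨IsPacking.subst hA.1.1, eq_univ_of_forall fun x => ?_⟩, fun P hP hfin => ?_⟩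
  · obtain ⟨t, ht, hx⟩ := hA.exists_mem (S.lam⁻¹ • x)
    obtain ⟨s, hs, hxs⟩ := S.lam_smul_mem_iff.2 hx
    rw [smul_inv_smul₀ S.lam_ne_zero] at hxs
    simp only [mem_iUnion, exists_prop]
    exact ⟨s, S.mem_subst.2 ⟨t, ht, hs⟩, hxs⟩
  · have h : ∀ s ∈ P, ∃ t ∈ A, s ∈ translatePatch (S.sub t.idx) (S.lam • t.pos) :=
      fun s hs => S.mem_subst.1 (hP hs)
    choose! f hfA hf using h
    obtain ⟨k, hk, j, v, h⟩ := hA.2 (f '' P) (image_subset_iff.2 hfA) (hfin.image f)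
    refine ⟨k + 1, by omega, j, S.lam • v, ?_⟩
    rw [Function.iterate_succ_apply', ← subst_translatePatch]
    exact fun s hs => S.subst_mono h (S.mem_subst.2 ⟨f s, mem_image_of_mem f hs, hf s hs⟩)

theorem MemOmega.subst_iterate {A : Set (Tile d ι)} (hA : S.MemOmega A) (n : ℕ) :
    S.MemOmega (S.subst^[n] A) := by
  induction n with
  | zero => exact hA
  | succ n ih =>
    rw [Function.iterate_succ_apply']
    exact ih.subst

/-- A tiling is maximal among packings. -/
theorem IsTiling.eq_of_subset {A B : Set (Tile d ι)} (hA : S.IsTiling A) (hB : S.IsPacking B)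
    (h : A ⊆ B) : A = B := by
  refine h.antisymm fun s hs => ?_
  obtain ⟨x, hx⟩ := S.interior_supp_nonempty s
  have : x ∈ ⋃ t ∈ A, S.supp t := hA.2 ▸ mem_univ x
  simp only [mem_iUnion, exists_prop] at this
  obtain ⟨t, ht, hxt⟩ := this
  rw [← closure_interior_supp] at hxt
  obtain ⟨y, hy, hy'⟩ := mem_closure_iff.1 hxt _ isOpen_interior hx
  by_contra hsA
  refine Set.disjoint_left.1 (hB hs (h ht) ?_) hy hy'
  rintro rfl
  exact hsA ht

/-! ### Surjectivity of the substitution and aperiodicity -/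

variable (S) in
/-- A tile has finitely many possible parents. -/
theorem finite_parents [Finite ι] (s : Tile d ι) :
    {q : Tile d ι | s ∈ translatePatch (S.sub q.idx) (S.lam • q.pos)}.Finite := by
  refine Finite.of_finite_image (f := fun q => (q.idx, s.translate (-(S.lam • q.pos))))
    ((Set.finite_univ.prod (finite_iUnion S.sub_finite)).subset ?_) ?_
  · rintro _ ⟨q, hq, rfl⟩
    exact ⟨mem_univ _, mem_iUnion.2 ⟨_, mem_translatePatch.1 hq⟩⟩
  · intro p _ q _ hpq
    simp only [Prod.mk.injEq, Tile.translate, Tile.mk.injEq, true_and, add_right_inj, neg_inj]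
      at hpq
    exact Tile.ext hpq.1 (smul_right_injective _ S.lam_ne_zero hpq.2)

variable (S) in
theorem isPacking_subst_iterate_singleton (k : ℕ) (t : Tile d ι) :
    S.IsPacking (S.subst^[k] {t}) := by
  induction k with
  | zero => exact pairwise_singleton _ _
  | succ k ih =>
    rw [Function.iterate_succ_apply']
    exact ih.subst

theorem MemOmega.exists_subset_subst [Finite ι] (hprim : S.IsPrimitive) {A : Set (Tile d ι)}
    (hA : S.MemOmega A) {P : Set (Tile d ι)} (hP : P ⊆ A) (hfin : P.Finite) :
    ∃ k : ℕ, 1 ≤ k ∧ ∃ (j : ι) (u : EuclideanSpace ℝ (Fin d)),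
      P ⊆ S.subst (translatePatch (S.subst^[k] {⟨j, 0⟩}) u) := by
  obtain ⟨k, hk, j, u, h⟩ := hA.2 P hP hfin
  obtain ⟨N, hN, hprim⟩ := hprim
  obtain ⟨t, ht, htj⟩ := hprim j j
  refine ⟨k + N - 1, by omega, j, S.lam⁻¹ • (-(S.lam ^ k • t.pos) + u), ?_⟩
  rw [subst_translatePatch, ← Function.iterate_succ_apply' S.subst,
    smul_inv_smul₀ S.lam_ne_zero, show (k + N - 1).succ = k + N by omega,
    Function.iterate_add_apply, ← translatePatch_add]
  refine h.trans (translatePatch_mono ?_ u)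
  rw [← smul_neg, ← subst_iterate_translatePatch]
  refine S.subst_iterate_mono ?_ k
  rw [singleton_subset_iff, mem_translatePatch]
  simpa [Tile.translate, ← htj] using ht

theorem MemOmega.exists_subst_eq [Finite ι] (hprim : S.IsPrimitive) {A : Set (Tile d ι)}
    (hA : S.MemOmega A) : ∃ B, S.MemOmega B ∧ S.subst B = A := by
  classical
  have h : ∀ F : Finset A, ∃ Q : Set (Tile d ι), (∃ k : ℕ, 1 ≤ k ∧ ∃ (j : ι) (u : _),
      Q = translatePatch (S.subst^[k] {⟨j, 0⟩}) u) ∧ Subtype.val '' (F : Set A) ⊆ S.subst Q := by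
    intro F
    obtain ⟨k, hk, j, u, h⟩ := hA.exists_subset_subst hprim (P := Subtype.val '' (F : Set A))
      (by rintro _ ⟨t, -, rfl⟩; exact t.2) (F.finite_toSet.image _)
    exact ⟨_, ⟨k, hk, j, u, rfl⟩, h⟩
  choose Q hQ hFQ using h
  let U : Ultrafilter (Finset A) := Ultrafilter.of atTop
  have hU : (U : Filter (Finset A)) ≤ atTop := Ultrafilter.of_le _
  let B : Set (Tile d ι) := {q | ∀ᶠ F in (U : Filter (Finset A)), q ∈ Q F}
  have hparent : ∀ s ∈ A, ∃ q ∈ B, s ∈ translatePatch (S.sub q.idx) (S.lam • q.pos) := by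
    intro s hs
    have h1 : ∀ᶠ F in (U : Filter (Finset A)), ∃ q ∈ {q : Tile d ι |
        s ∈ translatePatch (S.sub q.idx) (S.lam • q.pos)}, q ∈ Q F := by
      filter_upwards [hU (eventually_ge_atTop ({⟨s, hs⟩} : Finset A))] with F hF
      obtain ⟨q, hq, hsq⟩ := S.mem_subst.1
        (hFQ F ⟨⟨s, hs⟩, Finset.singleton_subset_iff.1 hF, rfl⟩)
      exact ⟨q, hsq, hq⟩
    obtain ⟨q, hq, hqB⟩ := (Ultrafilter.eventually_exists_mem_iff (S.finite_parents s)).1 h1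
    exact ⟨q, hqB, hq⟩
  have hsub : A ⊆ S.subst B := fun s hs => S.mem_subst.2 (hparent s hs)
  have hpack : S.IsPacking B := by
    intro q hq q' hq' hne
    obtain ⟨F, hF, hF'⟩ := (Eventually.and hq hq').exists
    obtain ⟨k, -, j, u, hk⟩ := hQ F
    have := IsPacking.translate (S.isPacking_subst_iterate_singleton k ⟨j, 0⟩) u
    rw [← hk] at this
    exact this hF hF' hne
  refine ⟨B, ⟨⟨hpack, eq_univ_of_forall fun x => ?_⟩, fun P hP hfin => ?_⟩, ?_⟩
  · obtain ⟨s, hs, hx⟩ := hA.exists_mem (S.lam • x)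
    obtain ⟨q, hq, hsq⟩ := hparent s hs
    simp only [mem_iUnion, exists_prop]
    exact ⟨q, hq, S.lam_smul_mem_iff.1 ⟨s, hsq, hx⟩⟩
  · have : ∀ᶠ F in (U : Filter (Finset A)), ∀ q ∈ P, q ∈ Q F :=
      (eventually_all_finite hfin).2 fun q hq => hP hq
    obtain ⟨F, hF⟩ := this.exists
    obtain ⟨k, hk, j, u, h⟩ := hQ F
    exact ⟨k, hk, j, u, fun q hq => h ▸ hF q hq⟩
  · exact (hA.1.eq_of_subset hpack.subst hsub).symm

theorem MemOmega.exists_subst_iterate_eq [Finite ι] (hprim : S.IsPrimitive) {A : Set (Tile d ι)}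
    (hA : S.MemOmega A) (n : ℕ) : ∃ B, S.MemOmega B ∧ S.subst^[n] B = A := by
  induction n with
  | zero => exact ⟨A, hA, rfl⟩
  | succ n ih =>
    obtain ⟨B, hB, hBA⟩ := ih
    obtain ⟨C, hC, hCB⟩ := hB.exists_subst_eq hprim
    exact ⟨C, hC, by rw [Function.iterate_succ_apply, hCB, hBA]⟩

/-- Tilings in `Ω` have no periods. -/
theorem MemOmega.eq_zero_of_translatePatch_eq [Finite ι] (hprim : S.IsPrimitive)
    (hinj : S.IsInjective) {A : Set (Tile d ι)} (hA : S.MemOmega A)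
    {w : EuclideanSpace ℝ (Fin d)} (h : translatePatch A w = A) : w = 0 := by
  have key : ∀ n : ℕ, ∃ B, S.MemOmega B ∧
      translatePatch B ((S.lam ^ n)⁻¹ • w) = B := by
    intro n
    induction n with
    | zero => exact ⟨A, hA, by simpa using h⟩
    | succ n ih =>
      obtain ⟨B, hB, hBw⟩ := ih
      obtain ⟨C, hC, rfl⟩ := hB.exists_subst_eq hprim
      refine ⟨C, hC, hinj (hC.translate _) hC ?_⟩
      rw [subst_translatePatch, smul_smul, pow_succ, mul_inv, mul_comm, mul_assoc,
        inv_mul_cancel₀ S.lam_ne_zero, mul_one, hBw]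
  obtain ⟨n, hn⟩ := S.exists_lt_lam_pow_mul ‖w‖ S.sep_pos
  obtain ⟨B, hB, hBw⟩ := key n
  obtain ⟨t, ht, -⟩ := hB.exists_mem 0
  have := hB.isPacking.eq_zero_of_translate_mem (u := (S.lam ^ n)⁻¹ • w) ht
    (hBw.subset (Tile.translate_mem_translatePatch ht)) (by
      rw [norm_smul, norm_inv, Real.norm_of_nonneg (S.lam_pow_pos n).le,
        inv_mul_lt_iff₀ (S.lam_pow_pos n)]
      exact hn)
  exact (smul_eq_zero.1 this).resolve_left (inv_ne_zero (S.lam_pow_ne_zero n))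

theorem MemOmega.translatePatch_inj [Finite ι] (hprim : S.IsPrimitive)
    (hinj : S.IsInjective) {A : Set (Tile d ι)} (hA : S.MemOmega A)
    {u v : EuclideanSpace ℝ (Fin d)} :
    translatePatch A u = translatePatch A v ↔ u = v := by
  refine ⟨fun h => ?_, fun h => by rw [h]⟩
  have := congrArg (fun B => translatePatch B (-v)) h
  simp only [translatePatch_add, add_neg_cancel, translatePatch_zero] at this
  simpa [add_neg_eq_zero] using hA.eq_zero_of_translatePatch_eq hprim hinj this

/-! ### The topology of the tiling space -/

theorem tilingDist_le_of_closeBy {A B : Set (Tile d ι)} {ε : ℝ}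
    {u v : EuclideanSpace ℝ (Fin d)} (h : S.CloseBy A B ε u v) : S.tilingDist A B ≤ ε :=
  csInf_le (S.bddBelow_dist A B) (Or.inr ⟨u, v, h⟩)

theorem exists_closeBy_of_tilingDist_lt {A B : Set (Tile d ι)} {ε : ℝ} (hε : ε ≤ 1 / √2)
    (h : S.tilingDist A B < ε) : ∃ δ < ε, ∃ u v, S.CloseBy A B δ u v := by
  obtain ⟨δ, hδ, hlt⟩ := exists_lt_of_csInf_lt
    (s := {1 / √2} ∪ {ε | ∃ u v, S.CloseBy A B ε u v}) ⟨_, Or.inl rfl⟩ h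
  rcases hδ with rfl | ⟨u, v, huv⟩
  · exact absurd hlt hε.not_gt
  · exact ⟨δ, hlt, u, v, huv⟩

theorem CloseBy.agreeOn {A B : Set (Tile d ι)} {ε : ℝ} {u v : EuclideanSpace ℝ (Fin d)}
    (h : S.CloseBy A B ε u v) : S.AgreeOn A (translatePatch B (v - u)) (ball (-u) (1 / ε)) := by
  have := h.2.2.translate (V := ball (-u) (1 / ε)) (-u) fun x hx => by
    rw [mem_ball_iff_norm] at hx ⊢
    simpa using hx
  simpa [translatePatch_add, sub_eq_add_neg] using this

theorem inv_sqrt_two_lt_one : (1 : ℝ) / √2 < 1 := by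
  rw [div_lt_one (by positivity)]
  exact Real.lt_sqrt_of_sq_lt (by norm_num)

variable (S) in
/-- Sufficiently close tilings agree on a large ball up to a small translation. -/
theorem exists_tilingDist_lt_imp_agreeOn (r : ℝ) {δ : ℝ} (hδ : 0 < δ) : ∃ η > 0,
    ∀ A B : Set (Tile d ι), S.tilingDist A B < η →
      ∃ w, ‖w‖ < δ ∧ S.AgreeOn A (translatePatch B w) (ball 0 r) := by
  refine ⟨min (min (δ / 2) (1 / (|r| + 1))) (1 / √2), by positivity, fun A B h => ?_⟩
  obtain ⟨ε, hε, u, v, huv⟩ := exists_closeBy_of_tilingDist_lt (min_le_right _ _) h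
  simp only [lt_min_iff] at hε
  have hpos := huv.pos
  refine ⟨v - u, ?_, huv.agreeOn.mono (ball_subset_ball' ?_)⟩
  · linarith [norm_sub_le v u, huv.1, huv.2.1]
  · rw [dist_zero_left, norm_neg]
    have h1 : |r| + 1 < 1 / ε := by
      rw [lt_div_iff₀ hpos, mul_comm, ← lt_div_iff₀ (by positivity)]
      exact hε.1.2
    linarith [le_abs_self r, huv.1, hε.2, inv_sqrt_two_lt_one]

theorem tilingDist_translatePatch_le (A : Set (Tile d ι)) (w : EuclideanSpace ℝ (Fin d)) :
    S.tilingDist A (translatePatch A w) ≤ ‖w‖ / 2 := by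
  refine le_of_forall_gt_imp_ge_of_dense fun ε hε => ?_
  have h2 : ‖(2⁻¹ : ℝ) • w‖ = ‖w‖ / 2 := by
    rw [norm_smul, Real.norm_of_nonneg (by norm_num)]
    ring
  refine tilingDist_le_of_closeBy (u := (2⁻¹ : ℝ) • w) (v := -((2⁻¹ : ℝ) • w)) ⟨?_, ?_, ?_⟩
  · rwa [h2]
  · rwa [norm_neg, h2]
  · rw [translatePatch_add]
    have : w + -((2⁻¹ : ℝ) • w) = (2⁻¹ : ℝ) • w := by module
    rw [this]
    rfl

theorem MemOmega.eq_of_tilingDist_eq_zero [Finite ι] {A B : Set (Tile d ι)} (hA : S.MemOmega A)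
    (hB : S.MemOmega B) (h : S.tilingDist A B = 0) : A = B := by
  have key : ∀ A B : Set (Tile d ι), S.MemOmega B → S.tilingDist A B = 0 → A ⊆ B := by
    intro A B hB h t ht
    obtain ⟨x, hx⟩ := S.interior_supp_nonempty t
    replace hx := interior_subset hx
    have h1 : ∀ δ > 0, ∃ w, ‖w‖ < δ ∧ t.translate (-w) ∈ B := by
      intro δ hδ
      obtain ⟨η, hη, h1⟩ := S.exists_tilingDist_lt_imp_agreeOn (‖x‖ + 1) hδ
      obtain ⟨w, hw, hAB⟩ := h1 A B (h ▸ hη)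
      exact ⟨w, hw, mem_translatePatch.1 ((hAB.mem_iff hx (by simp)).1 ht)⟩
    obtain ⟨w, hw, hwB⟩ := h1 (S.sep / 2) (half_pos S.sep_pos)
    by_cases hw0 : w = 0
    · simpa [hw0, Tile.translate] using hwB
    · obtain ⟨w', hw', hwB'⟩ := h1 (min ‖w‖ (S.sep / 2))
        (lt_min (norm_pos_iff.2 hw0) (half_pos S.sep_pos))
      rw [lt_min_iff] at hw'
      have := hB.isPacking.eq_of_dist_lt hwB hwB' rfl (by
        have e : (t.translate (-w)).pos - (t.translate (-w')).pos = w' - w := by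
          simp only [Tile.translate]; abel
        rw [e]
        linarith [norm_sub_le w' w])
      simp only [Tile.translate, Tile.mk.injEq, true_and, add_right_inj, neg_inj] at this
      exact absurd hw'.1 (by rw [this]; exact lt_irrefl _)
  exact (key A B hB h).antisymm (key B A hA (S.tilingDist_comm A B ▸ h))

instance instT2SpaceOmega [Finite ι] : T2Space S.Omega := by
  have : T0Space S.Omega := by
    refine ⟨fun A B h => Subtype.ext (A.2.eq_of_tilingDist_eq_zero B.2 ?_)⟩
    exact Metric.inseparable_iff.1 h
  infer_instance

theorem tilingDist_subst_iterate_le (n : ℕ) (A B : Set (Tile d ι)) :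
    S.tilingDist (S.subst^[n] A) (S.subst^[n] B) ≤ S.lam ^ n * S.tilingDist A B := by
  have hpos := S.lam_pow_pos n
  have hone : 1 ≤ S.lam ^ n := one_le_pow₀ S.one_lt_lam.le
  rw [← inv_mul_le_iff₀ hpos]
  refine le_csInf ⟨_, Or.inl rfl⟩ ?_
  rintro ε (rfl | ⟨u, v, h⟩)
  · rw [inv_mul_le_iff₀ hpos]
    refine (S.tilingDist_le _ _).trans (le_mul_of_one_le_left (by positivity) hone)
  · rw [inv_mul_le_iff₀ hpos]
    have hε := h.pos
    refine tilingDist_le_of_closeBy (u := S.lam ^ n • u) (v := S.lam ^ n • v) ⟨?_, ?_, ?_⟩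
    · rw [norm_smul, Real.norm_of_nonneg hpos.le]
      exact mul_lt_mul_of_pos_left h.1 hpos
    · rw [norm_smul, Real.norm_of_nonneg hpos.le]
      exact mul_lt_mul_of_pos_left h.2.1 hpos
    · rw [← subst_iterate_translatePatch, ← subst_iterate_translatePatch]
      refine h.2.2.subst_iterate n fun x hx => ?_
      rw [mem_ball_zero_iff] at hx ⊢
      rw [norm_smul, norm_inv, Real.norm_of_nonneg hpos.le, inv_mul_lt_iff₀ hpos]
      refine hx.trans_le ?_
      rw [mul_one_div]
      gcongr
      exact le_mul_of_one_le_left hε.le hone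

/-- The substitution map `ω^n` on `Ω`. -/
def Omega.subst (n : ℕ) (A : S.Omega) : S.Omega := ⟨S.subst^[n] A.1, A.2.subst_iterate n⟩

theorem Omega.continuous_subst (n : ℕ) : Continuous (Omega.subst (S := S) n) :=
  (LipschitzWith.of_dist_le_mul (K := ⟨S.lam ^ n, (S.lam_pow_pos n).le⟩) fun A B =>
    tilingDist_subst_iterate_le n A.1 B.1).continuous

/-- The translate `A + u` of a tiling in `Ω`. -/
def Omega.translate (A : S.Omega) (u : EuclideanSpace ℝ (Fin d)) : S.Omega :=
  ⟨translatePatch A.1 u, A.2.translate u⟩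

theorem Omega.continuous_translate (A : S.Omega) : Continuous A.translate := by
  refine (LipschitzWith.of_dist_le_mul (K := 1) fun u v => ?_).continuous
  have h := S.tilingDist_translatePatch_le (translatePatch A.1 u) (v - u)
  rw [translatePatch_add, add_sub_cancel] at h
  refine h.trans ?_
  rw [dist_eq_norm', NNReal.coe_one, one_mul]
  linarith [norm_nonneg (v - u)]

theorem Omega.translate_injective [Finite ι] (hprim : S.IsPrimitive) (hinj : S.IsInjective)
    (A : S.Omega) : Function.Injective A.translate := fun _ _ h =>
  (A.2.translatePatch_inj hprim hinj).1 (congrArg Subtype.val h)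

theorem Omega.eventually_agreeOn (A : S.Omega) (r : ℝ) {δ : ℝ} (hδ : 0 < δ) :
    ∀ᶠ B in 𝓝 A, ∃ w, ‖w‖ < δ ∧ S.AgreeOn B.1 (translatePatch A.1 w) (ball 0 r) := by
  obtain ⟨η, hη, h⟩ := S.exists_tilingDist_lt_imp_agreeOn r hδ
  filter_upwards [ball_mem_nhds A hη] with B hB
  exact h _ _ hB

end SubstitutionRule

/-! ### Inductive limit topologies -/

section IndLim

variable {Y Z : Type*} [TopologicalSpace Y] [TopologicalSpace Z] {X : ℕ → Set Y}

theorem isOpen_indLimTopology {U : Set {y : Y // y ∈ ⋃ n, X n}} :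
    IsOpen[indLimTopology X] U ↔
      ∀ n, ∃ O, IsOpen O ∧ ∀ y (hy : y ∈ X n), y ∈ O ↔ ⟨y, mem_iUnion.2 ⟨n, hy⟩⟩ ∈ U := by
  simp only [isOpen_iSup_iff, isOpen_coinduced, isOpen_induced_iff,
    Set.ext_iff, mem_preimage, Subtype.forall]

theorem continuous_indLimTopology_iff {f : {y : Y // y ∈ ⋃ n, X n} → Z} :
    Continuous[indLimTopology X, _] f ↔
      ∀ n, Continuous fun y : X n => f ⟨y.1, mem_iUnion.2 ⟨n, y.2⟩⟩ := by
  simp only [continuous_iSup_dom, continuous_coinduced_dom]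
  rfl

/-- A continuous map to `Y` that locally takes values in a single `X n` is continuous for the
inductive limit topology. -/
theorem continuous_to_indLimTopology {f : Z → {y : Y // y ∈ ⋃ n, X n}}
    (hf : Continuous fun z => (f z).1) (h : ∀ z, ∃ n, ∀ᶠ z' in 𝓝 z, (f z').1 ∈ X n) :
    Continuous[_, indLimTopology X] f := by
  refine (@continuous_def _ _ _ (indLimTopology X) _).2 fun U hU =>
    isOpen_iff_mem_nhds.2 fun z hz => ?_
  obtain ⟨n, hn⟩ := h z
  obtain ⟨O, hO, hOU⟩ := isOpen_indLimTopology.1 hU n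
  have hzO : (f z).1 ∈ O := (hOU _ hn.self_of_nhds).2 hz
  filter_upwards [hn, hf.continuousAt.eventually (hO.mem_nhds hzO)] with z' h1 h2
  exact (hOU _ h1).1 h2

end IndLim

namespace SubstitutionRule

variable {d : ℕ} {ι : Type*} {S : SubstitutionRule d ι}

/-! ### The unstable classes -/

theorem memLocalUnstable_iff {ε₀ : ℝ} {A B : Set (Tile d ι)} :
    S.MemLocalUnstable ε₀ A B ↔ ∃ w, ‖w‖ < 2 * ε₀ ∧ B = translatePatch A w := by
  constructor
  · rintro ⟨-, ε, hε, u, v, h, hB⟩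
    exact ⟨v - u, by linarith [norm_sub_le v u, h.1, h.2.1], hB⟩
  · rintro ⟨w, hw, rfl⟩
    refine ⟨(S.tilingDist_translatePatch_le A w).trans_lt (by linarith), ?_⟩
    obtain ⟨ε, hε, hε'⟩ := exists_between (show ‖w‖ / 2 < ε₀ by linarith)
    have h2 : ‖(2⁻¹ : ℝ) • w‖ = ‖w‖ / 2 := by
      rw [norm_smul, Real.norm_of_nonneg (by norm_num)]
      ring
    refine ⟨ε, hε', -((2⁻¹ : ℝ) • w), (2⁻¹ : ℝ) • w, ⟨?_, ?_, ?_⟩, ?_⟩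
    · rwa [norm_neg, h2]
    · rwa [h2]
    · rw [translatePatch_add, show w + -((2⁻¹ : ℝ) • w) = (2⁻¹ : ℝ) • w by module]
      rfl
    · rw [show (2⁻¹ : ℝ) • w - -((2⁻¹ : ℝ) • w) = w by module]

theorem mem_unstableStep_iff [Finite ι] (hprim : S.IsPrimitive) {ε₀ : ℝ} {T T' : S.Omega} {n : ℕ} :
    T' ∈ S.unstableStep ε₀ T n ↔ ∃ x, ‖x‖ < S.lam ^ n * (2 * ε₀) ∧ T' = T.translate (-x) := by
  have hpos := S.lam_pow_pos n
  constructor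
  · rintro ⟨A, A', hA, h, hT'⟩
    obtain ⟨w, hw, hAw⟩ := memLocalUnstable_iff.1 h
    refine ⟨-(S.lam ^ n • w), ?_, Subtype.ext ?_⟩
    · rw [norm_neg, norm_smul, Real.norm_of_nonneg hpos.le]
      exact mul_lt_mul_of_pos_left hw hpos
    · rw [hT', hAw, subst_iterate_translatePatch, hA, neg_neg]
      rfl
  · rintro ⟨x, hx, rfl⟩
    obtain ⟨A, hA, hAT⟩ := T.2.exists_subst_iterate_eq hprim n
    refine ⟨⟨A, hA⟩, Omega.translate ⟨A, hA⟩ (-((S.lam ^ n)⁻¹ • x)), hAT,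
      memLocalUnstable_iff.2 ⟨_, ?_, rfl⟩, ?_⟩
    · rw [norm_neg, norm_smul, norm_inv, Real.norm_of_nonneg hpos.le, inv_mul_lt_iff₀ hpos]
      exact hx
    · simp only [Omega.translate, subst_iterate_translatePatch, hAT, smul_neg,
        smul_inv_smul₀ hpos.ne']

theorem translate_neg_mem_iUnion_unstableStep [Finite ι] (hprim : S.IsPrimitive) {ε₀ : ℝ}
    (hε₀ : 0 < ε₀) (T : S.Omega) (x : EuclideanSpace ℝ (Fin d)) :
    T.translate (-x) ∈ ⋃ n, S.unstableStep ε₀ T n := by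
  obtain ⟨n, hn⟩ := S.exists_lt_lam_pow_mul ‖x‖ (show 0 < 2 * ε₀ by linarith)
  exact mem_iUnion.2 ⟨n, (mem_unstableStep_iff hprim).2 ⟨x, hn, rfl⟩⟩

/-- The homeomorphism `x ↦ T - x` from `ℝ^d` to the unstable class of `T`. -/
theorem exists_homeomorph_unstableClass [Finite ι] (hprim : S.IsPrimitive) (hinj : S.IsInjective)
    {ε₀ : ℝ} (hε₀ : 0 < ε₀) (T : S.Omega) :
    ∃ χ : EuclideanSpace ℝ (Fin d) ≃ₜ S.UnstableClass ε₀ T,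
      ∀ x, (χ x).1 = T.translate (-x) := by
  have hTinj : Function.Injective fun x => T.translate (-x) :=
    (T.translate_injective hprim hinj).comp neg_injective
  have hTcont : Continuous fun x => T.translate (-x) := T.continuous_translate.comp continuous_neg
  let f : EuclideanSpace ℝ (Fin d) → S.UnstableClass ε₀ T := fun x =>
    ⟨T.translate (-x), translate_neg_mem_iUnion_unstableStep hprim hε₀ T x⟩
  have hfinj : Function.Injective f := fun x y h => hTinj (congrArg Subtype.val h)
  have hfsurj : Function.Surjective f := by
    rintro ⟨T', hT'⟩
    obtain ⟨n, hn⟩ := mem_iUnion.1 hT'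
    obtain ⟨x, -, rfl⟩ := (mem_unstableStep_iff hprim).1 hn
    exact ⟨x, rfl⟩
  let e := Equiv.ofBijective f ⟨hfinj, hfsurj⟩
  have he : ∀ p, T.translate (-(e.symm p)) = p.1 := fun p =>
    congrArg Subtype.val (e.apply_symm_apply p)
  have hcont : Continuous e := by
    refine continuous_to_indLimTopology hTcont fun x => ?_
    obtain ⟨n, hn⟩ := S.exists_lt_lam_pow_mul ‖x‖ (show 0 < 2 * ε₀ by linarith)
    refine ⟨n, ?_⟩
    filter_upwards [continuous_norm.continuousAt.eventually_lt_const hn] with y hy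
    exact (mem_unstableStep_iff hprim).2 ⟨y, hy, rfl⟩
  have hcont' : Continuous e.symm := by
    refine continuous_indLimTopology_iff.2 fun n => ?_
    let K := closedBall (0 : EuclideanSpace ℝ (Fin d)) (S.lam ^ n * (2 * ε₀))
    have hK : CompactSpace K := isCompact_iff_compactSpace.1 (isCompact_closedBall _ _)
    let g : K → S.Omega := fun x => T.translate (-x.1)
    have hg : Topology.IsClosedEmbedding g :=
      (hTcont.comp continuous_subtype_val).isClosedEmbedding
        (hTinj.comp Subtype.val_injective)
    have hmem : ∀ p : S.unstableStep ε₀ T n,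
        e.symm ⟨p.1, mem_iUnion.2 ⟨n, p.2⟩⟩ ∈ K := by
      intro p
      obtain ⟨x, hx, hpx⟩ := (mem_unstableStep_iff hprim).1 p.2
      have : e.symm ⟨p.1, mem_iUnion.2 ⟨n, p.2⟩⟩ = x := hTinj ((he _).trans hpx)
      rw [this]
      exact mem_closedBall_zero_iff.2 hx.le
    have : Continuous fun p : S.unstableStep ε₀ T n => (⟨_, hmem p⟩ : K) := by
      rw [hg.isInducing.continuous_iff]
      convert continuous_subtype_val using 1
      exact funext fun p => he _
    exact continuous_subtype_val.comp this
  exact ⟨⟨e, hcont, hcont'⟩, fun x => rfl⟩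

/-! ### The stable relation -/

theorem memLocalStable_iff [Finite ι] (hprim : S.IsPrimitive) (hinj : S.IsInjective) {ε₀ : ℝ}
    {A B : Set (Tile d ι)} (hB : S.MemOmega B) :
    S.MemLocalStable ε₀ A B ↔ ∃ ε < ε₀, ∃ u, ‖u‖ < ε ∧ S.AgreeOn A B (ball u (1 / ε)) := by
  constructor
  · rintro ⟨-, ε, hε, u, v, h, hBB⟩
    have huv := hB.eq_zero_of_translatePatch_eq hprim hinj hBB.symm
    have := h.agreeOn
    rw [huv, translatePatch_zero] at this
    exact ⟨ε, hε, -u, by simpa using h.1, this⟩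
  · rintro ⟨ε, hε, u, hu, h⟩
    have hclose : S.CloseBy A B ε (-u) (-u) := by
      refine ⟨by simpa using hu, by simpa using hu, h.translate (-u) fun x hx => ?_⟩
      rw [mem_ball_iff_norm] at hx ⊢
      simpa using hx
    exact ⟨(tilingDist_le_of_closeBy hclose).trans_lt hε, ε, hε, -u, -u, hclose, by simp⟩

theorem MemLocalStable.agreeOn_zero [Finite ι] (hprim : S.IsPrimitive) (hinj : S.IsInjective)
    {ε₀ : ℝ} (hε₀ : ε₀ < 1 / √2) {A B : Set (Tile d ι)} (hB : S.MemOmega B)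
    (h : S.MemLocalStable ε₀ A B) : S.AgreeOn A B {0} := by
  obtain ⟨ε, hε, u, hu, hAB⟩ := (memLocalStable_iff hprim hinj hB).1 h
  refine hAB.mono (singleton_subset_iff.2 ?_)
  have hpos : 0 < ε := (norm_nonneg u).trans_lt hu
  have : ε < 1 := (hε.trans hε₀).trans inv_sqrt_two_lt_one
  have := one_lt_one_div hpos this
  rw [mem_ball, dist_zero_left]
  linarith

/-- Near a locally stable pair, the pairs that are eventually identified by the substitution at the
origin are locally stable as well. -/
theorem MemLocalStable.eventually [Finite ι] (hprim : S.IsPrimitive) (hinj : S.IsInjective)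
    {ε₀ : ℝ} (hε₀ : ε₀ < 1 / √2) {A B : S.Omega} (h : S.MemLocalStable ε₀ A.1 B.1) (m : ℕ) :
    ∀ᶠ p in 𝓝 (A, B), S.AgreeOn (S.subst^[m] p.1.1) (S.subst^[m] p.2.1) {0} →
      S.MemLocalStable ε₀ p.1.1 p.2.1 := by
  obtain ⟨ε, hε, u, hu, hAB⟩ := (memLocalStable_iff hprim hinj B.2).1 h
  have hpos : 0 < ε := (norm_nonneg u).trans_lt hu
  obtain ⟨ε', hε', hε''⟩ := exists_between hε
  have hpos' : 0 < ε' := hpos.trans hε'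
  have hlt : 1 / ε' < 1 / ε := one_div_lt_one_div_of_lt hpos hε'
  have hgap : 0 < 1 / ε - ‖u‖ := by
    have := one_lt_one_div hpos ((hε.trans hε₀).trans inv_sqrt_two_lt_one)
    linarith [(hε.trans hε₀).trans inv_sqrt_two_lt_one]
  obtain ⟨δ, hδpos, hδ⟩ : ∃ δ > 0, δ < 1 / ε - ‖u‖ ∧ δ < 1 / ε - 1 / ε' ∧
      S.lam ^ m * δ ≤ S.sep / 2 := by
    have h3 : 0 < S.sep / 2 / S.lam ^ m := div_pos (half_pos S.sep_pos) (S.lam_pow_pos m)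
    obtain ⟨δ, h0, h1⟩ := exists_between (lt_min (lt_min hgap (sub_pos.2 hlt)) h3)
    rw [lt_min_iff, lt_min_iff] at h1
    refine ⟨δ, h0, h1.1.1, h1.1.2, ?_⟩
    rw [mul_comm]
    exact ((lt_div_iff₀ (S.lam_pow_pos m)).1 h1.2).le
  have hev := (A.eventually_agreeOn (1 / ε' + ‖u‖) hδpos).prod_nhds
    (B.eventually_agreeOn (1 / ε' + ‖u‖) hδpos)
  filter_upwards [hev] with p hp hm
  obtain ⟨⟨a, ha, hpA⟩, b, hb, hpB⟩ := hp
  have hzero : (0 : EuclideanSpace ℝ (Fin d)) ∈ ball (0 : EuclideanSpace ℝ (Fin d))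
      (1 / ε' + ‖u‖) := mem_ball_self (by positivity)
  have hmA := hpA.subst_iterate m (V := {0}) (by simpa using hzero)
  have hmB := hpB.subst_iterate m (V := {0}) (by simpa using hzero)
  obtain ⟨t, ht, ht0⟩ := (p.1.2.subst_iterate m).exists_mem 0
  have htA := (hmA.mem_iff ht0 rfl).1 ht
  have htB := (hmB.mem_iff ht0 rfl).1 ((hm.mem_iff ht0 rfl).1 ht)
  rw [subst_iterate_translatePatch, mem_translatePatch] at htA htB
  have htA' : t.translate (-(S.lam ^ m • a)) ∈ S.subst^[m] B.1 := by
    refine (((hAB.subst_iterate m (V := {-(S.lam ^ m • a)}) ?_).mem_iff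
      (x := -(S.lam ^ m • a)) ?_ rfl)).1 htA
    · rintro _ rfl
      rw [smul_neg, inv_smul_smul₀ (S.lam_pow_ne_zero m), mem_ball_iff_norm]
      have := norm_sub_le (-a) u
      rw [norm_neg] at this
      linarith
    · rw [mem_supp_translate]
      simpa using ht0
  have hab : a = b := by
    have := (B.2.subst_iterate m).isPacking.eq_zero_of_translate_mem (u := S.lam ^ m • (a - b))
      htA' (by
        convert htB using 1
        simp only [Tile.translate, Tile.mk.injEq, true_and]
        module) (by
        rw [norm_smul, Real.norm_of_nonneg (S.lam_pow_pos m).le]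
        calc S.lam ^ m * ‖a - b‖ < S.lam ^ m * (δ + δ) := by
              refine mul_lt_mul_of_pos_left ?_ (S.lam_pow_pos m)
              linarith [norm_sub_le a b]
          _ ≤ S.sep := by linarith)
    exact sub_eq_zero.1 ((smul_eq_zero.1 this).resolve_left (S.lam_pow_ne_zero m))
  subst hab
  have hAB' : S.AgreeOn (translatePatch A.1 a) (translatePatch B.1 a) (ball u (1 / ε')) :=
    hAB.translate a fun x hx => by
      rw [mem_ball_iff_norm] at hx ⊢
      have := norm_sub_le (x - u) a
      rw [sub_right_comm] at this
      linarith
  have hsub : ball u (1 / ε') ⊆ ball 0 (1 / ε' + ‖u‖) :=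
    ball_subset_ball' (by rw [dist_zero_right])
  exact (memLocalStable_iff hprim hinj p.2.2).2 ⟨ε', hε'', u, hu.trans hε',
    ((hpA.mono hsub).trans hAB').trans (hpB.mono hsub).symm⟩

/-- The steps `G_n` are open in the stable relation. -/
theorem isOpen_stableStep [Finite ι] (hprim : S.IsPrimitive) (hinj : S.IsInjective) {ε₀ : ℝ}
    (hε₀ : ε₀ < 1 / √2) (n : ℕ) :
    IsOpen[(S.stableRel ε₀).top] {g | g.1 ∈ S.stableStep ε₀ n} := by
  refine isOpen_indLimTopology.2 fun m => ?_
  let O : Set (S.Omega × S.Omega) := {p | p ∈ S.stableStep ε₀ m → p ∈ S.stableStep ε₀ n}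
  refine ⟨interior O, isOpen_interior, fun p hp => ⟨fun h => interior_subset h hp, fun h => ?_⟩⟩
  rw [mem_interior_iff_mem_nhds]
  have hc : Continuous fun p : S.Omega × S.Omega => (p.1.subst n, p.2.subst n) :=
    ((Omega.continuous_subst n).comp continuous_fst).prodMk
      ((Omega.continuous_subst n).comp continuous_snd)
  have h' : S.MemLocalStable ε₀ (p.1.subst n).1 (p.2.subst n).1 := h
  filter_upwards [hc.continuousAt.eventually (h'.eventually hprim hinj hε₀ m)] with q hq hqm
  refine hq ?_
  have h0 := MemLocalStable.agreeOn_zero hprim hinj hε₀ (q.2.2.subst_iterate m) hqm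
  have := h0.subst_iterate n (V := {0}) (by simp)
  simp only [← Function.iterate_add_apply, Omega.subst] at this ⊢
  rwa [add_comm m n]

end SubstitutionRule

/-! ### Étale relations given by translations -/

/-- A copy of a type, with the discrete topology. -/
def DiscreteCopy (X : Type*) : Type _ := X

namespace DiscreteCopy

variable {X : Type*}

instance : TopologicalSpace (DiscreteCopy X) := ⊥

instance : DiscreteTopology (DiscreteCopy X) := ⟨rfl⟩

instance [AddCommGroup X] : AddCommGroup (DiscreteCopy X) := inferInstanceAs (AddCommGroup X)

/-- The identity map to the discrete copy. -/
def mk (x : X) : DiscreteCopy X := x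

/-- The identity map from the discrete copy. -/
def val (x : DiscreteCopy X) : X := x

theorem continuous_val [TopologicalSpace X] : Continuous (val : DiscreteCopy X → X) :=
  continuous_of_discreteTopology

theorem isLocalHomeomorph_fst {Y : Type*} [TopologicalSpace Y] :
    IsLocalHomeomorph (Prod.fst : Y × DiscreteCopy X → Y) := by
  refine IsLocalHomeomorph.mk _ fun p => ⟨
    { toFun := Prod.fst
      invFun := fun y => (y, p.2)
      source := {q | q.2 = p.2}
      target := univ
      map_source' := fun _ _ => mem_univ _
      map_target' := fun _ _ => rfl
      left_inv' := fun q hq => Prod.ext rfl hq.symm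
      right_inv' := fun _ _ => rfl
      open_source := (isOpen_discrete {p.2}).preimage continuous_snd
      open_target := isOpen_univ
      continuousOn_toFun := continuous_fst.continuousOn
      continuousOn_invFun := (by fun_prop : Continuous fun y : Y => (y, p.2)).continuousOn },
    rfl, fun _ _ => rfl⟩

end DiscreteCopy

namespace TopRelation

section Translation

variable {E : Type*} [AddCommGroup E] [TopologicalSpace E]

/-- The arrow `(x, y)` as a pair of its range `x` and its displacement `y - x`. -/
def displacement (R : TopRelation E) (g : R.Arrow) : E × DiscreteCopy E :=
  (g.range, DiscreteCopy.mk (g.source - g.range))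

/-- An equivalence relation on a topological group that is open for the topology in which only
pairs with the same displacement are close to each other is étale. -/
theorem isEtale_of_isOpenEmbedding_displacement [IsTopologicalAddGroup E] {R : TopRelation E}
    (hR : R.IsEquivalence) (h : IsOpenEmbedding R.displacement) : R.IsEtale := by
  have hfst : Continuous (Prod.fst ∘ R.displacement) := continuous_fst.comp h.continuous
  change Continuous fun g : R.Arrow => g.range at hfst
  have hsnd : Continuous fun g : R.Arrow => DiscreteCopy.mk (g.source - g.range) :=
    continuous_snd.comp h.continuous
  have hsource : Continuous fun g : R.Arrow => g.source := by
    have := hfst.add (DiscreteCopy.continuous_val.comp hsnd)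
    convert this using 2 with g
    exact (add_sub_cancel _ _).symm
  have hinv : Continuous (R.inv hR) := by
    rw [h.isInducing.continuous_iff]
    refine hsource.prodMk ?_
    have hneg : Continuous fun a : DiscreteCopy E => -a := continuous_of_discreteTopology
    convert hneg.comp hsnd using 2 with g
    exact (neg_sub _ _).symm
  have hcomp : Continuous (R.comp hR) := by
    rw [h.isInducing.continuous_iff]
    refine (hfst.comp (continuous_fst.comp continuous_subtype_val)).prodMk ?_
    have hadd : Continuous fun a : DiscreteCopy E × DiscreteCopy E => a.1 + a.2 :=
      continuous_of_discreteTopology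
    convert hadd.comp ((hsnd.comp (continuous_fst.comp continuous_subtype_val)).prodMk
      (hsnd.comp (continuous_snd.comp continuous_subtype_val))) using 2 with p
    have hp := p.2
    change p.1.2.source - p.1.1.range =
      (p.1.1.source - p.1.1.range) + (p.1.2.source - p.1.2.range)
    rw [← hp]
    abel
  have hrange : IsLocalHomeomorph (Prod.fst ∘ R.displacement) :=
    DiscreteCopy.isLocalHomeomorph_fst.comp h.isLocalHomeomorph
  change IsLocalHomeomorph (Arrow.range : R.Arrow → E) at hrange
  let e : R.Arrow ≃ₜ R.Arrow := ⟨⟨R.inv hR, R.inv hR, fun _ => rfl, fun _ => rfl⟩, hinv, hinv⟩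
  exact ⟨⟨hR, hinv, hcomp⟩, hrange, hrange.comp e.isLocalHomeomorph⟩

end Translation

/-- A homeomorphism between arrow spaces that is induced by a bijection of the unit spaces
transports the structure of a topological groupoid, and is then an isomorphism. -/
theorem isTopGroupoidIso_of_homeomorph {X Y : Type*} {R : TopRelation X} {Q : TopRelation Y}
    (hR : R.IsTopologicalGroupoid) (e : X ≃ Y) (φ : R.Arrow ≃ₜ Q.Arrow)
    (hrange : ∀ g, (φ g).range = e g.range) (hsource : ∀ g, (φ g).source = e g.source) :
    IsTopGroupoidIso R Q φ := by
  have hrange' : ∀ g, (φ.symm g).range = e.symm g.range := fun g => by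
    rw [Equiv.eq_symm_apply, ← hrange, φ.apply_symm_apply]
  have hsource' : ∀ g, (φ.symm g).source = e.symm g.source := fun g => by
    rw [Equiv.eq_symm_apply, ← hsource, φ.apply_symm_apply]
  have hmem : ∀ x y : X, (x, y) ∈ R.rel ↔ (e x, e y) ∈ Q.rel := by
    intro x y
    constructor
    · intro h
      have h1 := (φ ⟨(x, y), h⟩).2
      have h2 := hrange ⟨(x, y), h⟩
      have h3 := hsource ⟨(x, y), h⟩
      exact (show (φ ⟨(x, y), h⟩).1 = (e x, e y) from Prod.ext h2 h3) ▸ h1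
    · intro h
      have h1 := (φ.symm ⟨(e x, e y), h⟩).2
      have h2 : (φ.symm ⟨(e x, e y), h⟩).range = x := (hrange' _).trans (e.symm_apply_apply x)
      have h3 : (φ.symm ⟨(e x, e y), h⟩).source = y := (hsource' _).trans (e.symm_apply_apply y)
      exact (show (φ.symm ⟨(e x, e y), h⟩).1 = (x, y) from Prod.ext h2 h3) ▸ h1
  have hmem' : ∀ x y : Y, (x, y) ∈ Q.rel ↔ (e.symm x, e.symm y) ∈ R.rel := fun x y => by
    rw [hmem, e.apply_symm_apply, e.apply_symm_apply]
  have hQ : Q.IsEquivalence :=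
    ⟨fun x => (hmem' x x).2 (hR.equivalence.refl _),
      fun h => (hmem' _ _).2 (hR.equivalence.symm ((hmem' _ _).1 h)),
      fun h h' => (hmem' _ _).2 (hR.equivalence.trans ((hmem' _ _).1 h) ((hmem' _ _).1 h'))⟩
  have hext : ∀ g h : Q.Arrow, g.range = h.range → g.source = h.source → g = h :=
    fun g h h1 h2 => Subtype.ext (Prod.ext h1 h2)
  have hinv : Q.inv hQ = φ ∘ R.inv hR.equivalence ∘ φ.symm := by
    refine funext fun g => hext _ _ ?_ ?_
    · refine Eq.trans ?_ (hrange _).symm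
      change g.source = e (φ.symm g).source
      rw [hsource', e.apply_symm_apply]
    · refine Eq.trans ?_ (hsource _).symm
      change g.range = e (φ.symm g).range
      rw [hrange', e.apply_symm_apply]
  have hcompos : ∀ p : Q.Composable, (φ.symm p.1.1).source = (φ.symm p.1.2).range := fun p => by
    rw [hsource', hrange', p.2]
  have hcomp : Q.comp hQ = φ ∘ R.comp hR.equivalence ∘
      fun p : Q.Composable => ⟨(φ.symm p.1.1, φ.symm p.1.2), hcompos p⟩ := by
    refine funext fun p => hext _ _ ?_ ?_
    · refine Eq.trans ?_ (hrange _).symm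
      change p.1.1.range = e (φ.symm p.1.1).range
      rw [hrange', e.apply_symm_apply]
    · refine Eq.trans ?_ (hsource _).symm
      change p.1.2.source = e (φ.symm p.1.2).source
      rw [hsource', e.apply_symm_apply]
  refine ⟨hR, ⟨hQ, ?_, ?_⟩, φ.isHomeomorph, fun g h => ?_, fun p => hext _ _ ?_ ?_⟩
  · rw [hinv]
    exact φ.continuous.comp (hR.continuous_inv.comp φ.symm.continuous)
  · rw [hcomp]
    refine φ.continuous.comp (hR.continuous_comp.comp (Continuous.subtype_mk ?_ _))
    exact (φ.symm.continuous.comp (continuous_fst.comp continuous_subtype_val)).prodMk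
      (φ.symm.continuous.comp (continuous_snd.comp continuous_subtype_val))
  · rw [hsource, hrange, e.apply_eq_iff_eq]
  · exact (hrange _).trans (hrange p.1.1).symm
  · exact (hsource _).trans (hsource p.1.2).symm

end TopRelation

namespace SubstitutionRule

variable {d : ℕ} {ι : Type*} {S : SubstitutionRule d ι}

/-! ### The relation on `ℝ^d` -/

theorem translatePatch_tilesAt_singleton (A : Set (Tile d ι)) (x : EuclideanSpace ℝ (Fin d)) :
    translatePatch (S.tilesAt A {x}) (-x) = S.tilesAt (translatePatch A (-x)) {0} := by
  rw [tilesAt_translate]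
  congr 2
  ext y
  simp

open Pointwise in
theorem mem_relStep_iff {T : S.Omega} {n : ℕ} {x y : EuclideanSpace ℝ (Fin d)} :
    (x, y) ∈ S.relStep T n ↔
      S.AgreeOn (S.subst^[n] (T.translate (-x)).1) (S.subst^[n] (T.translate (-y)).1) {0} := by
  change (x, y) ∈ (S.lam ^ n)⁻¹ • S.tilingRel (S.subst^[n] T.1) ↔ _
  rw [mem_inv_smul_set_iff₀ (S.lam_pow_ne_zero n)]
  change translatePatch (S.tilesAt (S.subst^[n] T.1) {S.lam ^ n • x}) (-(S.lam ^ n • x)) =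
    translatePatch (S.tilesAt (S.subst^[n] T.1) {S.lam ^ n • y}) (-(S.lam ^ n • y)) ↔ _
  rw [translatePatch_tilesAt_singleton, translatePatch_tilesAt_singleton]
  simp only [Omega.translate, subst_iterate_translatePatch, smul_neg]
  rfl

theorem relStep_mono (T : S.Omega) : Monotone (S.relStep T) := by
  refine monotone_nat_of_le_succ fun n => ?_
  rintro ⟨x, y⟩ h
  rw [mem_relStep_iff] at h ⊢
  rw [Function.iterate_succ_apply', Function.iterate_succ_apply']
  exact h.subst (by simp)

theorem isEquivalence_unionRel (T : S.Omega) : (S.unionRel T).IsEquivalence := by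
  refine ⟨fun x => mem_iUnion.2 ⟨0, mem_relStep_iff.2 rfl⟩, fun h => ?_, fun h h' => ?_⟩
  · obtain ⟨n, hn⟩ := mem_iUnion.1 h
    exact mem_iUnion.2 ⟨n, mem_relStep_iff.2 (mem_relStep_iff.1 hn).symm⟩
  · obtain ⟨n, hn⟩ := mem_iUnion.1 h
    obtain ⟨m, hm⟩ := mem_iUnion.1 h'
    exact mem_iUnion.2 ⟨max n m, mem_relStep_iff.2
      ((mem_relStep_iff.1 (relStep_mono T (le_max_left n m) hn)).trans
        (mem_relStep_iff.1 (relStep_mono T (le_max_right n m) hm)))⟩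

theorem MemOmega.eventually_sub_eq [Finite ι] {A : Set (Tile d ι)} (hA : S.MemOmega A)
    {x y : EuclideanSpace ℝ (Fin d)}
    (h : S.AgreeOn (translatePatch A (-x)) (translatePatch A (-y)) {0}) :
    ∀ᶠ q in 𝓝 (x, y), S.AgreeOn (translatePatch A (-q.1)) (translatePatch A (-q.2)) {0} →
      q.2 - q.1 = y - x := by
  have h1 := (hA.isPacking.eventually_mem_supp x).prod_inl_nhds y
  have h2 := (hA.isPacking.eventually_mem_supp y).prod_inr_nhds x
  have h3 : ∀ᶠ q in 𝓝 (x, y), ‖(q.2 - q.1) - (y - x)‖ < S.sep := by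
    have : Continuous fun q : EuclideanSpace ℝ (Fin d) × EuclideanSpace ℝ (Fin d) =>
      ‖(q.2 - q.1) - (y - x)‖ := by fun_prop
    exact this.continuousAt.eventually_lt_const (by simpa using S.sep_pos)
  filter_upwards [h1, h2, h3] with q h1 h2 h3 hq
  have key : ∀ {a b : EuclideanSpace ℝ (Fin d)} {t : Tile d ι},
      S.AgreeOn (translatePatch A (-a)) (translatePatch A (-b)) {0} → t ∈ A → a ∈ S.supp t →
        t.translate (b - a) ∈ A := by
    intro a b t hab ht hat
    have := (hab.mem_iff (t := t.translate (-a)) (x := 0)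
      (by rw [mem_supp_translate]; simpa using hat) rfl).1 (Tile.translate_mem_translatePatch ht)
    rw [mem_translatePatch] at this
    convert this using 1
    simp only [Tile.translate, Tile.mk.injEq, true_and]
    abel
  obtain ⟨t, ht, hqt⟩ := hA.exists_mem q.1
  have ht' := key hq ht hqt
  have hy : y ∈ S.supp (t.translate (q.2 - q.1)) := by
    refine h2 _ ht' ?_
    rw [mem_supp_translate]
    simpa using hqt
  have ht'' := key h.symm ht' hy
  refine sub_eq_zero.1 (hA.isPacking.eq_zero_of_translate_mem ht ?_ h3)
  convert ht'' using 1
  simp only [Tile.translate, Tile.mk.injEq, true_and]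
  abel

/-- Displacements are locally constant on each `R_n`. -/
theorem eventually_sub_eq_of_mem_relStep [Finite ι] {T : S.Omega} {n : ℕ}
    {x y : EuclideanSpace ℝ (Fin d)} (h : (x, y) ∈ S.relStep T n) :
    ∀ᶠ q in 𝓝 (x, y), q ∈ S.relStep T n → q.2 - q.1 = y - x := by
  have hmem : ∀ {a b : EuclideanSpace ℝ (Fin d)}, (a, b) ∈ S.relStep T n ↔
      S.AgreeOn (translatePatch (S.subst^[n] T.1) (-(S.lam ^ n • a)))
        (translatePatch (S.subst^[n] T.1) (-(S.lam ^ n • b))) {0} := by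
    intro a b
    rw [mem_relStep_iff]
    simp only [Omega.translate, subst_iterate_translatePatch, smul_neg]
  have hc : Continuous fun q : EuclideanSpace ℝ (Fin d) × EuclideanSpace ℝ (Fin d) =>
      (S.lam ^ n • q.1, S.lam ^ n • q.2) := by fun_prop
  filter_upwards [hc.continuousAt.eventually
    ((T.2.subst_iterate n).eventually_sub_eq (hmem.1 h))] with q hq hqn
  have := hq (hmem.1 hqn)
  simp only [← smul_sub] at this
  exact smul_right_injective _ (S.lam_pow_ne_zero n) this

theorem exists_agreeOn_of_mem_relStep [Finite ι] {T : S.Omega} {n : ℕ}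
    {x y : EuclideanSpace ℝ (Fin d)} (h : (x, y) ∈ S.relStep T n) :
    ∃ r > 0, ∀ w, ‖w‖ < r → S.AgreeOn (S.subst^[n] (T.translate (-(x + w))).1)
      (S.subst^[n] (T.translate (-(y + w))).1) (ball 0 r) := by
  obtain ⟨r, hr, hr'⟩ := IsPacking.exists_agreeOn_ball
    ((T.translate (-x)).2.subst_iterate n).isPacking
    ((T.translate (-y)).2.subst_iterate n).isPacking (mem_relStep_iff.1 h)
  have hpos := S.lam_pow_pos n
  have hone : 1 ≤ S.lam ^ n := one_le_pow₀ S.one_lt_lam.le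
  refine ⟨r / (2 * S.lam ^ n), by positivity, fun w hw => ?_⟩
  have e : ∀ z, (T.translate (-(z + w))).1 = translatePatch (T.translate (-z)).1 (-w) := fun z => by
    simp only [Omega.translate, translatePatch_add, neg_add]
  rw [e, e, subst_iterate_translatePatch, subst_iterate_translatePatch]
  refine hr'.translate _ fun z hz => ?_
  rw [mem_ball_zero_iff] at hz ⊢
  have h1 : ‖S.lam ^ n • w‖ < r / 2 := by
    rw [norm_smul, Real.norm_of_nonneg hpos.le]
    rw [lt_div_iff₀ (by positivity)] at hw
    linarith
  have h2 : r / (2 * S.lam ^ n) ≤ r / 2 := by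
    gcongr
    linarith
  rw [smul_neg, sub_neg_eq_add]
  linarith [norm_add_le z (S.lam ^ n • w)]

theorem eventually_add_mem_relStep [Finite ι] {T : S.Omega} {n : ℕ}
    {x y : EuclideanSpace ℝ (Fin d)} (h : (x, y) ∈ S.relStep T n) :
    ∀ᶠ w in 𝓝 0, (x + w, y + w) ∈ S.relStep T n := by
  obtain ⟨r, hr, h'⟩ := exists_agreeOn_of_mem_relStep h
  filter_upwards [ball_mem_nhds 0 hr] with w hw
  rw [mem_ball_zero_iff] at hw
  exact mem_relStep_iff.2 ((h' w hw).mono (singleton_subset_iff.2 (mem_ball_self hr)))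

/-- The topology of `R'_s` is the one in which pairs are close iff they have the same displacement
and their ranges are close. -/
theorem isOpenEmbedding_displacement [Finite ι] (T : S.Omega) :
    IsOpenEmbedding (S.unionRel T).displacement := by
  have hcont : Continuous (S.unionRel T).displacement := by
    refine continuous_indLimTopology_iff.2 fun n => ?_
    refine (continuous_fst.comp continuous_subtype_val).prodMk
      (IsLocallyConstant.continuous ((IsLocallyConstant.iff_eventually_eq _).2 ?_))
    rintro ⟨⟨x, y⟩, h⟩
    filter_upwards [continuous_subtype_val.continuousAt.eventually
      (eventually_sub_eq_of_mem_relStep h)] with q hq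
    exact hq q.2
  have hinj : Function.Injective (S.unionRel T).displacement := by
    rintro ⟨⟨x, y⟩, h⟩ ⟨⟨x', y'⟩, h'⟩ heq
    have h1 : x = x' := congrArg Prod.fst heq
    have h2 : y - x = y' - x' := congrArg Prod.snd heq
    subst h1
    have h3 : y = y' := sub_left_injective h2
    subst h3
    rfl
  refine IsOpenEmbedding.of_continuous_injective_isOpenMap hcont hinj fun U hU => ?_
  refine isOpen_iff_mem_nhds.2 ?_
  rintro _ ⟨⟨⟨x, y⟩, h⟩, hg, rfl⟩
  obtain ⟨n, hn⟩ := mem_iUnion.1 h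
  obtain ⟨O, hO, hOU⟩ := isOpen_indLimTopology.1 hU n
  have hc : Continuous fun w : EuclideanSpace ℝ (Fin d) => (x + w, y + w) := by fun_prop
  have hO' : ∀ᶠ w in 𝓝 (0 : EuclideanSpace ℝ (Fin d)), (x + w, y + w) ∈ O :=
    hc.continuousAt.eventually (hO.mem_nhds (by simpa using (hOU _ hn).2 hg))
  have hc' : Continuous fun p :
      EuclideanSpace ℝ (Fin d) × DiscreteCopy (EuclideanSpace ℝ (Fin d)) =>
      p.1 - x := by fun_prop
  have htend : Tendsto (fun p : EuclideanSpace ℝ (Fin d) ×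
      DiscreteCopy (EuclideanSpace ℝ (Fin d)) => p.1 - x)
      (𝓝 (x, DiscreteCopy.mk (y - x))) (𝓝 0) := by
    simpa using hc'.tendsto (x, DiscreteCopy.mk (y - x))
  have hdisc : ∀ᶠ p : EuclideanSpace ℝ (Fin d) × DiscreteCopy (EuclideanSpace ℝ (Fin d)) in
      𝓝 (x, DiscreteCopy.mk (y - x)), p.2 = DiscreteCopy.mk (y - x) :=
    (continuous_snd.tendsto _).eventually ((isOpen_discrete {_}).mem_nhds rfl)
  filter_upwards [htend.eventually ((eventually_add_mem_relStep hn).and hO'), hdisc] with p hp hp2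
  refine ⟨⟨_, mem_iUnion.2 ⟨n, hp.1⟩⟩, (hOU _ hp.1).1 hp.2, Prod.ext ?_ ?_⟩
  · exact add_sub_cancel x p.1
  · rw [hp2]
    exact add_sub_add_right_eq_sub y x (p.1 - x)

/-! ### Comparison of the two relations -/

theorem mem_relStep_of_mem_stableStep [Finite ι] (hprim : S.IsPrimitive) (hinj : S.IsInjective)
    {ε₀ : ℝ} (hε₀ : ε₀ < 1 / √2) {T : S.Omega} {n : ℕ} {x y : EuclideanSpace ℝ (Fin d)}
    (h : (T.translate (-x), T.translate (-y)) ∈ S.stableStep ε₀ n) : (x, y) ∈ S.relStep T n :=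
  mem_relStep_iff.2
    (MemLocalStable.agreeOn_zero hprim hinj hε₀ ((T.translate (-y)).2.subst_iterate n) h)

theorem exists_eventually_mem_stableStep [Finite ι] (hprim : S.IsPrimitive) (hinj : S.IsInjective)
    {ε₀ : ℝ} (hε₀ : 0 < ε₀) {T : S.Omega} {n : ℕ} {x y : EuclideanSpace ℝ (Fin d)}
    (h : (x, y) ∈ S.relStep T n) : ∃ m, ∀ᶠ w in 𝓝 0,
      (T.translate (-(x + w)), T.translate (-(y + w))) ∈ S.stableStep ε₀ m := by
  obtain ⟨r, hr, h'⟩ := exists_agreeOn_of_mem_relStep h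
  obtain ⟨k, hk⟩ := S.exists_lt_lam_pow_mul (1 / (ε₀ / 2)) hr
  refine ⟨k + n, ?_⟩
  filter_upwards [ball_mem_nhds 0 hr] with w hw
  rw [mem_ball_zero_iff] at hw
  refine (memLocalStable_iff hprim hinj ((T.translate _).2.subst_iterate _)).2
    ⟨ε₀ / 2, half_lt_self hε₀, 0, by simpa using hε₀, ?_⟩
  rw [Function.iterate_add_apply, Function.iterate_add_apply]
  refine (h' w hw).subst_iterate k fun z hz => ?_
  rw [mem_ball_zero_iff] at hz ⊢
  rw [norm_smul, norm_inv, Real.norm_of_nonneg (S.lam_pow_pos k).le,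
    inv_mul_lt_iff₀ (S.lam_pow_pos k)]
  exact hz.trans hk

theorem mem_stableRel_iff [Finite ι] (hprim : S.IsPrimitive) (hinj : S.IsInjective)
    {ε₀ : ℝ} (hε₀ : 0 < ε₀) (hε₀' : ε₀ < 1 / √2) {T : S.Omega}
    {x y : EuclideanSpace ℝ (Fin d)} :
    (T.translate (-x), T.translate (-y)) ∈ (S.stableRel ε₀).rel ↔ (x, y) ∈ (S.unionRel T).rel := by
  constructor
  · intro h
    obtain ⟨n, hn⟩ := mem_iUnion.1 h
    exact mem_iUnion.2 ⟨n, mem_relStep_of_mem_stableStep hprim hinj hε₀' hn⟩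
  · intro h
    obtain ⟨n, hn⟩ := mem_iUnion.1 h
    obtain ⟨m, hm⟩ := exists_eventually_mem_stableStep hprim hinj hε₀ hn
    exact mem_iUnion.2 ⟨m, by simpa using hm.self_of_nhds⟩

theorem continuous_range_transversal {ε₀ : ℝ} (T : S.Omega) :
    Continuous (TopRelation.Arrow.range : (S.transversal ε₀ T).Arrow → S.UnstableClass ε₀ T) :=
  continuous_iff_le_induced.2 (inf_le_right.trans inf_le_left)

theorem continuous_source_transversal {ε₀ : ℝ} (T : S.Omega) :
    Continuous (TopRelation.Arrow.source : (S.transversal ε₀ T).Arrow → S.UnstableClass ε₀ T) :=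
  continuous_iff_le_induced.2 (inf_le_right.trans inf_le_right)

theorem isOpen_transversal_of_isOpen_stableRel {ε₀ : ℝ} (T : S.Omega)
    {G : Set (S.Omega × S.Omega)} (hG : IsOpen[(S.stableRel ε₀).top] {g | g.1 ∈ G}) :
    IsOpen {g : (S.transversal ε₀ T).Arrow | (g.range.1, g.source.1) ∈ G} := by
  have h : (S.transversal ε₀ T).top ≤ TopologicalSpace.induced
    (fun p => ⟨(p.1.1.1, p.1.2.1), p.2⟩) (S.stableRel ε₀).top := inf_le_left
  exact h _ ⟨_, hG, rfl⟩

theorem exists_homeomorph_transversal [Finite ι] (hprim : S.IsPrimitive) (hinj : S.IsInjective)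
    {ε₀ : ℝ} (hε₀ : 0 < ε₀) (hε₀' : ε₀ < 1 / √2) (T : S.Omega)
    (χ : EuclideanSpace ℝ (Fin d) ≃ₜ S.UnstableClass ε₀ T)
    (hχ : ∀ x, (χ x).1 = T.translate (-x)) :
    ∃ φ : (S.unionRel T).Arrow ≃ₜ (S.transversal ε₀ T).Arrow,
      ∀ g, (φ g).range = χ g.range ∧ (φ g).source = χ g.source := by
  have hmem : ∀ p : S.UnstableClass ε₀ T × S.UnstableClass ε₀ T,
      p ∈ (S.transversal ε₀ T).rel ↔ (χ.symm p.1, χ.symm p.2) ∈ (S.unionRel T).rel := by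
    intro p
    rw [← mem_stableRel_iff hprim hinj hε₀ hε₀', ← hχ, ← hχ, χ.apply_symm_apply,
      χ.apply_symm_apply]
    rfl
  let e : (S.unionRel T).Arrow ≃ (S.transversal ε₀ T).Arrow :=
    { toFun := fun g => ⟨(χ g.range, χ g.source), (hmem _).2 (by
        simp only [χ.symm_apply_apply]
        exact g.2)⟩
      invFun := fun g => ⟨(χ.symm g.range, χ.symm g.source), (hmem _).1 g.2⟩
      left_inv := fun g => Subtype.ext
        (Prod.ext (χ.symm_apply_apply _) (χ.symm_apply_apply _))
      right_inv := fun g => Subtype.ext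
        (Prod.ext (χ.apply_symm_apply _) (χ.apply_symm_apply _)) }
  have hopen := isOpenEmbedding_displacement T
  have hetale := TopRelation.isEtale_of_isOpenEmbedding_displacement
    (isEquivalence_unionRel T) hopen
  have hrange := hetale.range_localHomeo.continuous
  have hsource := hetale.source_localHomeo.continuous
  have hcont : Continuous e := by
    have hχr : Continuous fun g : (S.unionRel T).Arrow => χ g.range := χ.continuous.comp hrange
    have hχs : Continuous fun g : (S.unionRel T).Arrow => χ g.source := χ.continuous.comp hsource
    refine continuous_inf_rng.2 ⟨continuous_induced_rng.2 ?_, continuous_inf_rng.2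
      ⟨continuous_induced_rng.2 ?_, continuous_induced_rng.2 ?_⟩⟩
    rotate_left
    · exact hχr
    · exact hχs
    refine continuous_to_indLimTopology ?_ fun g => ?_
    · have hT : ∀ {f : (S.unionRel T).Arrow → EuclideanSpace ℝ (Fin d)}, Continuous f →
          Continuous fun g => (χ (f g)).1 := by
        intro f hf
        simp only [hχ]
        exact T.continuous_translate.comp hf.neg
      exact (hT hrange).prodMk (hT hsource)
    · obtain ⟨n, hn⟩ := mem_iUnion.1 g.2
      obtain ⟨m, hm⟩ := exists_eventually_mem_stableStep hprim hinj hε₀ hn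
      refine ⟨m, ?_⟩
      have htend : Tendsto (fun g' : (S.unionRel T).Arrow => g'.range - g.range) (𝓝 g) (𝓝 0) := by
        have hsub : Continuous fun g' : (S.unionRel T).Arrow => g'.range - g.range :=
          hrange.sub continuous_const
        simpa using hsub.tendsto g
      have hdisc : ∀ᶠ g' in 𝓝 g, ((S.unionRel T).displacement g').2 =
          ((S.unionRel T).displacement g).2 :=
        ((continuous_snd.comp hopen.continuous).tendsto g).eventually
          ((isOpen_discrete {_}).mem_nhds rfl)
      filter_upwards [htend.eventually hm, hdisc] with g' h1 h2
      have h2' : g'.source - g'.range = g.source - g.range := h2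
      have h3 : g.1.1 + (g'.range - g.range) = g'.range := add_sub_cancel _ _
      have h4 : g.1.2 + (g'.range - g.range) = g'.source := by
        change g.source + (g'.range - g.range) = g'.source
        rw [← sub_eq_zero] at h2' ⊢
        rw [← neg_eq_zero, ← h2']
        abel
      rw [h3, h4, ← hχ, ← hχ] at h1
      exact h1
  have hfst : Continuous fun g : (S.transversal ε₀ T).Arrow => χ.symm g.range :=
    χ.symm.continuous.comp (continuous_range_transversal T)
  have hsnd : Continuous fun g : (S.transversal ε₀ T).Arrow => χ.symm g.source :=
    χ.symm.continuous.comp (continuous_source_transversal T)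
  have hcont' : Continuous e.symm := by
    rw [hopen.isInducing.continuous_iff]
    refine hfst.prodMk
      (IsLocallyConstant.continuous ((IsLocallyConstant.iff_eventually_eq _).2 fun g => ?_))
    obtain ⟨n, hn⟩ := mem_iUnion.1 g.2
    have hstep : IsOpen {g : (S.transversal ε₀ T).Arrow |
        (g.range.1, g.source.1) ∈ S.stableStep ε₀ n} :=
      isOpen_transversal_of_isOpen_stableRel T (isOpen_stableStep hprim hinj hε₀' n)
    have hrel : ∀ g : (S.transversal ε₀ T).Arrow,
        (g.range.1, g.source.1) ∈ S.stableStep ε₀ n →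
          (χ.symm g.range, χ.symm g.source) ∈ S.relStep T n := by
      intro g hg
      refine mem_relStep_of_mem_stableStep hprim hinj hε₀' ?_
      rwa [← hχ, ← hχ, χ.apply_symm_apply, χ.apply_symm_apply]
    filter_upwards [hstep.mem_nhds hn, (hfst.prodMk hsnd).continuousAt.eventually
      (eventually_sub_eq_of_mem_relStep (hrel g hn))] with g' h1 h2
    exact h2 (hrel g' h1)
  exact ⟨⟨e, hcont, hcont'⟩, fun g => ⟨rfl, rfl⟩⟩

end SubstitutionRule

theorem propositionp {d : ℕ} (hd : 1 ≤ d) {ι : Type*} [Finite ι] (S : SubstitutionRule d ι)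
    (hprim : S.IsPrimitive) (hflc : S.HasFLC) (hinj : S.IsInjective)
    (ε₀ : ℝ) (hε₀ : 0 < ε₀) (hε₀' : ε₀ < 1 / √2) (T : S.Omega) :
    (S.unionRel T).IsEtale ∧
      ∃ φ : (S.unionRel T).Arrow → (S.transversal ε₀ T).Arrow,
        (∀ g : (S.unionRel T).Arrow,
          (φ g).range.1.1 = translatePatch T.1 (-g.range) ∧
            (φ g).source.1.1 = translatePatch T.1 (-g.source)) ∧
        TopRelation.IsTopGroupoidIso (S.unionRel T) (S.transversal ε₀ T) φ := by
  have hetale := TopRelation.isEtale_of_isOpenEmbedding_displacement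
    (SubstitutionRule.isEquivalence_unionRel T) (SubstitutionRule.isOpenEmbedding_displacement T)
  obtain ⟨χ, hχ⟩ := SubstitutionRule.exists_homeomorph_unstableClass hprim hinj hε₀ T
  obtain ⟨φ, hφ⟩ := SubstitutionRule.exists_homeomorph_transversal hprim hinj hε₀ hε₀' T χ hχ
  refine ⟨hetale, φ, fun g => ?_, TopRelation.isTopGroupoidIso_of_homeomorph hetale.groupoid
    χ.toEquiv φ (fun g => (hφ g).1) (fun g => (hφ g).2)⟩
  rw [(hφ g).1, (hφ g).2, hχ, hχ]
  exact ⟨rfl, rfl⟩
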